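/- **Setting.** Let $\mathcal X$ be a compact topological space of decisions, $\Sigma$ a finite set, and $\ell:\mathcal X\times\Sigma\to\mathbb R$ a loss such that $x\mapsto\ell(x,i)$ is continuous for every $i\in\Sigma$. Let $\mathcal P$ be the probability simplex over $\Sigma$ and $\mathcal P^{\mathrm o}=\{\mathbb P\in\mathcal P:\mathbb P(i)>0\ \forall i\}$ its relative interior. Write $c(x,\mathbb P)=\mathbb E_{\mathbb P}[\ell(x,\xi)]$. Under $\mathbb P^\infty$ the samples $\xi_1,\xi_2,\dots$ are i.i.d. with law $\mathbb P$, and $\hat{\mathbb P}_T$ is the empirical distribution of $\xi_1,\dots,\xi_T$. Let $(a_T)_{T\ge1}$ be a sequence of nonnegative reals with $a_T\to\infty$ and $a_T/T\to0$ (the subexponential regime). **Predictors.** A predictor $\hat c$ is a sequence of functions $\hat c(\cdot,\cdot,T):\mathcal X\times\mathcal P\to\mathbb R$, $T\ge1$. It is *regular* ($\hat c\in\mathcal C$) if 1. the sequence $(\hat c(\cdot,\cdot,T))_{T\ge1}$ is uniformly bounded and equicontinuous on $\mathcal X\times\mathcal P$; 2. for all $T$ and $x$, $\hat c(x,\cdot,T)$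 is differentiable at every $\mathbb P\in\mathcal P^{\mathrm o}$ (along the directions $\{\Delta\in\mathbb R^\Sigma:\sum_i\Delta_i=0\}$ of the simplex), and the sequence of the derivatives is equicontinuous on $\mathcal X\times\mathcal P^{\mathrm o}$ and, for every compact $Q\subset\mathcal P^{\mathrm o}$, uniformly bounded on $\mathcal X\times Q$. (Equicontinuous means that for each point $y$ and $\varepsilon>0$ there is a neighbourhood of $y$ on which, for all $T$ simultaneously, the values differ from the value at $y$ by less than $\varepsilon$.) The *out-of-sample guarantee* of $\hat c$ at $\mathbb P$ is $$\limsup_{T\to\infty}\frac1{a_T}\log\mathbb P^\infty\bigl(c(x,\mathbb P)>\hat c(x,\hat{\mathbb P}_T,T)\bigr)\le-1\qquad\text{for all }x\in\mathcal X ,$$ with $\log 0=-\infty$. Predictors are compared by $$\hat c_1\preceq_{\mathcal C}\hat c_2\iff\limsup_{T\to\infty}\frac{|\hat c_1(x,\mathbb P,T)-c(x,\mathbb P)|}{|\hat c_2(x,\mathbb P,T)-c(x,\mathbb P)|}\le1\quad\forall x\in\mathcal X,\ \forall\,\mathbb P\in\mathcal P^{\mathrm o},$$ with the conventions $\frac00=1$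 and $\frac u0=\infty$ for $u>0$. **Theorem (Strong optimality of $\hat c_{\mathrm V}$).** Let $$\hat c_{\mathrm V}(x,\mathbb P,T)=c(x,\mathbb P)+\sqrt{\frac{2a_T}{T}\,\mathrm{Var}_{\mathbb P}(\ell(x,\xi))}.$$ 1. $\hat c_{\mathrm V}$ is regular. 2. $\hat c_{\mathrm V}$ satisfies the out-of-sample guarantee at every $\mathbb P\in\mathcal P$. 3. For every regular predictor $\hat c$ that satisfies the out-of-sample guarantee at every $\mathbb P\in\mathcal P^{\mathrm o}$, we have $\hat c_{\mathrm V}\preceq_{\mathcal C}\hat c$. Moreover, for every such $\hat c$, all $x\in\mathcal X$ and all $\mathbb P\in\mathcal P^{\mathrm o}$, $$\liminf_{T\to\infty}\sqrt{\frac T{a_T}}\,\bigl(\hat c(x,\mathbb P,T)-c(x,\mathbb P)\bigr)\ \ge\ \sqrt{2\,\mathrm{Var}_{\mathbb P}(\ell(x,\xi))}.$$ -/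

import Mathlib

open Filter Topology MeasureTheory
open scoped ENNReal

/-- The probability simplex over the finite set `S`. -/
abbrev Simplex (S : Type*) [Fintype S] : Type _ := ↥(stdSimplex ℝ S)

/-- The (relative) interior of the simplex: all probabilities are positive. -/
def simplexInterior (S : Type*) [Fintype S] : Set (Simplex S) :=
  {P | ∀ i, 0 < P.1 i}

/-- The directions of the hyperplane that carries the simplex: vectors whose entries sum to `0`. -/
def tangent (S : Type*) [Fintype S] : Submodule ℝ (S → ℝ) where
  carrier := {Δ | ∑ i, Δ i = 0}
  add_mem' := by
    intro u v hu hv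
    simp only [Set.mem_ofPred_eq] at hu hv
    simp [Finset.sum_add_distrib, hu, hv]
  zero_mem' := by simp
  smul_mem' := by
    intro r u hu
    simp only [Set.mem_ofPred_eq] at hu
    simp [← Finset.mul_sum, hu]

/-- A predictor: a sequence, indexed by the sample size `T ≥ 1`, of functions of a decision and a
distribution. -/
abbrev Predictor (X S : Type*) [Fintype S] : Type _ := ℕ+ → X → Simplex S → ℝ

/-- The cost `c(x, P) = E_P[ℓ(x, ξ)]`. -/
noncomputable def cost {X S : Type*} [Fintype S] (l : X → S → ℝ) (x : X) (P : Simplex S) : ℝ :=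
  ∑ i, P.1 i * l x i

/-- The variance `Var_P(ℓ(x, ξ))`. -/
noncomputable def lossVar {X S : Type*} [Fintype S] (l : X → S → ℝ) (x : X) (P : Simplex S) : ℝ :=
  ∑ i, P.1 i * (l x i - cost l x P) ^ 2

/-- The sample variance penalization predictor. -/
noncomputable def svp {X S : Type*} [Fintype S] (l : X → S → ℝ) (a : ℕ+ → ℝ) : Predictor X S :=
  fun T x P => cost l x P + Real.sqrt (2 * a T / (T : ℝ) * lossVar l x P)

/-- A function `f` on the simplex, read near `P` as a function of the displacement `Δ` in the
tangent directions. (Off the simplex it is given the value `0`; when all `P i` are positive,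
`P + Δ` lies in the simplex for all small `Δ`.) -/
noncomputable def localRep {S : Type*} [Fintype S] (f : Simplex S → ℝ) (P : Simplex S) :
    tangent S → ℝ :=
  fun Δ => Function.extend (Subtype.val : Simplex S → S → ℝ) f 0 (P.1 + Δ.1)

/-- Differentiability, at an interior point `P`, of a function on the simplex. -/
def SimplexDifferentiableAt {S : Type*} [Fintype S] (f : Simplex S → ℝ) (P : Simplex S) : Prop :=
  DifferentiableAt ℝ (localRep f P) 0

/-- The derivative, at an interior point `P`, of a function on the simplex. -/
noncomputable def simplexDeriv {S : Type*} [Fintype S] (f : Simplex S → ℝ) (P : Simplex S) :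
    tangent S →L[ℝ] ℝ :=
  fderiv ℝ (localRep f P) 0

/-- Regular predictors. The predictor is uniformly bounded and equicontinuous on the whole of
`X × Simplex S`; it is differentiable in the distribution at interior points, and the sequence of
derivatives is equicontinuous on `X × simplexInterior S` and bounded, uniformly in the sample size
and the decision, on compact sets of interior distributions. -/
structure RegularPredictor {X S : Type*} [TopologicalSpace X] [Fintype S] (c : Predictor X S) : Prop where
  bounded : ∃ K : ℝ, ∀ (T : ℕ+) (x : X) (P : Simplex S), |c T x P| ≤ K
  equicontinuous : Equicontinuous (fun (T : ℕ+) (y : X × Simplex S) => c T y.1 y.2)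
  differentiable : ∀ (T : ℕ+) (x : X), ∀ P ∈ simplexInterior S, SimplexDifferentiableAt (c T x) P
  deriv_bounded : ∀ Q : Set (Simplex S), IsCompact Q → Q ⊆ simplexInterior S →
    ∃ K : ℝ, ∀ (T : ℕ+) (x : X), ∀ P ∈ Q, ‖simplexDeriv (c T x) P‖ ≤ K
  deriv_equicontinuous : EquicontinuousOn
    (fun (T : ℕ+) (y : X × Simplex S) => simplexDeriv (c T y.1) y.2)
    (Set.univ ×ˢ simplexInterior S)

/-- The probability measure on `S` with weights `P`. -/
noncomputable def simplexMeasure {S : Type*} [Fintype S] [MeasurableSpace S] (P : Simplex S) :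
    Measure S :=
  ∑ i, ENNReal.ofReal (P.1 i) • Measure.dirac i

instance simplexMeasure_isProbability {S : Type*} [Fintype S] [MeasurableSpace S]
    (P : Simplex S) :
    IsProbabilityMeasure (simplexMeasure P) := by
  constructor
  simp only [simplexMeasure, Measure.coe_finsetSum, Finset.sum_apply, Measure.smul_apply,
    measure_univ, smul_eq_mul, mul_one]
  rw [← ENNReal.ofReal_sum_of_nonneg (fun i _ => P.2.1 i), P.2.2, ENNReal.ofReal_one]

/-- The law `P^∞` of an infinite sequence of independent samples from `P`. -/
noncomputable def sampleLaw {S : Type*} [Fintype S] [MeasurableSpace S] (P : Simplex S) :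
    Measure (ℕ → S) :=
  Measure.infinitePi (fun _ : ℕ => simplexMeasure P)

/-- The empirical distribution of the first `T` samples. -/
noncomputable def empirical {S : Type*} [Fintype S] [DecidableEq S] (T : ℕ+) (ξ : ℕ → S) :
    Simplex S :=
  ⟨fun i => (((Finset.range T).filter (fun t => ξ t = i)).card : ℝ) / (T : ℝ), by
    refine ⟨fun i => by positivity, ?_⟩
    have h : ∑ i, ((Finset.range T).filter (fun t => ξ t = i)).card = (T : ℕ) := by
      have := Finset.card_eq_sum_card_fiberwise (f := ξ) (s := Finset.range T)
        (t := Finset.univ) (fun _ _ => Finset.mem_coe.2 (Finset.mem_univ _))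
      rw [← this, Finset.card_range]
    rw [← Finset.sum_div, ← Nat.cast_sum, h]
    exact div_self (by positivity)⟩

/-- The probability of disappointment `P^∞(c(x, P) > ĉ(x, P̂_T, T))`. -/
noncomputable def disappointment {X S : Type*} [Fintype S] [DecidableEq S] [MeasurableSpace S]
    (l : X → S → ℝ) (c : Predictor X S) (x : X) (P : Simplex S) (T : ℕ+) : ℝ≥0∞ :=
  sampleLaw P {ξ | cost l x P > c T x (empirical T ξ)}

/-- The out-of-sample guarantee with speed `a`, required for all true distributions in `Q`
(with `log 0 = -∞`). -/
def OutOfSampleGuarantee {X S : Type*} [Fintype S] [DecidableEq S] [MeasurableSpace S]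
    (l : X → S → ℝ) (a : ℕ+ → ℝ) (c : Predictor X S) (Q : Set (Simplex S)) : Prop :=
  ∀ x : X, ∀ P ∈ Q,
    limsup (fun T : ℕ+ => ((1 / a T : ℝ) : EReal) * ENNReal.log (disappointment l c x P T)) atTop
      ≤ -1

/-- The quotient of two nonnegative reals in `[0, ∞]`, with `0 / 0 = 1` and `u / 0 = ∞` for
`u > 0`. -/
noncomputable def ratio (u v : ℝ) : ℝ≥0∞ :=
  if u = 0 ∧ v = 0 then 1 else ENNReal.ofReal u / ENNReal.ofReal v

/-- The order on predictors: `c₁` asymptotically adds no more regularization than `c₂`. -/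
def Preferred {X S : Type*} [Fintype S] (l : X → S → ℝ) (c₁ c₂ : Predictor X S) : Prop :=
  ∀ x : X, ∀ P ∈ simplexInterior S,
    limsup (fun T : ℕ+ => ratio |c₁ T x P - cost l x P| |c₂ T x P - cost l x P|) atTop ≤ 1

/-! Write `v` for the variance at `P` and `τ = √(a T / T)`. At scale `τ` the empirical distribution
has Gaussian tails: a deviation of the mean loss by `y * τ` has probability about `exp (-(y² / (2 *
v)) * a T)`, so a guarantee at rate `1` must buy exactly `y = √(2 * v)`, which is what the variance
penalty adds. Sufficiency (`svp_guarantee`) is Chernoff's bound. Near `P` the variance at the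
empirical distribution is almost `v`; leaving that neighbourhood costs a rate linear in `T`, which
is negligible since `a T / T → 0`. Necessity (`eventually_lt_scaled_excess`) is by contradiction.
Suppose `ĉ ≤ cost + b * τ` at `P` with `b < √(2 * v)`. The guarantee at nearby distributions keeps
`ĉ` asymptotically above the cost, so `P` is almost a minimum of `ĉ - cost`, and the derivative of
`ĉ` along a fixed direction is close to that of the cost (`eventually_simplexDeriv_le`). Tilting `P`
by `s * τ` towards smaller losses therefore lowers `ĉ` by about `s * v * τ`, hence below the true
cost once `b < s * v`. The samples follow this tilt with probability about `exp (-(s² * v / 2) * a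
T)` (`eventually_le_sampleLaw_tilt`), and `s² * v / 2 < 1` contradicts the guarantee. Equicontinuity
of the derivatives makes the expansion uniform in `T`. Regularity (`svp_regular`) is delicate only
where the variance vanishes; at interior distributions the derivative of the standard deviation
tends to `0` there. -/

lemma Real.exp_le_quadratic_add_cube {x : ℝ} (hx : |x| ≤ 1) :
    Real.exp x ≤ 1 + x + x ^ 2 / 2 + |x| ^ 3 := by
  have h := (abs_le.1 (Real.exp_bound hx (n := 3) (by norm_num))).2
  simp only [Finset.sum_range_succ, Finset.sum_range_zero, Nat.factorial] at h
  norm_num at h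
  have := pow_nonneg (abs_nonneg x) 3
  linarith

/-! ### Empirical distributions: change of measure and Chernoff bounds. -/

section Sampling

variable {S : Type*} [Fintype S]

section MeasurableSpace

variable [MeasurableSpace S]

instance sampleLaw_isProbability (P : Simplex S) : IsProbabilityMeasure (sampleLaw P) := by
  unfold sampleLaw; infer_instance

variable [MeasurableSingletonClass S]

lemma simplexMeasure_real_singleton (P : Simplex S) (i : S) :
    (simplexMeasure P).real {i} = P.1 i := by
  classical
  rw [measureReal_def, simplexMeasure, Measure.coe_finsetSum, Finset.sum_apply,
    Finset.sum_eq_single i]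
  · simp [P.2.1 i]
  · intro j _ hj
    simp [hj]
  · simp

/-- An event that depends on finitely many samples has the probability given by a finite sum. -/
lemma sampleLaw_real_restrict_preimage (P : Simplex S) (I : Finset ℕ) (B : Set (I → S))
    [DecidablePred (· ∈ B)] :
    (sampleLaw P).real (I.restrict ⁻¹' B) = ∑ w with w ∈ B, ∏ t, P.1 (w t) := by
  have hB : MeasurableSet B := B.toFinite.measurableSet
  rw [measureReal_def, ← Measure.map_apply (Finset.measurable_restrict _) hB, sampleLaw,
    Measure.infinitePi_map_restrict, ← measureReal_def]
  have : B = ((Finset.univ.filter (· ∈ B) : Finset (I → S)) : Set (I → S)) := by ext; simp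
  conv_lhs => rw [this]
  rw [← sum_measureReal_singleton]
  refine Finset.sum_congr rfl fun w _ => ?_
  rw [measureReal_def, Measure.pi_singleton, ENNReal.toReal_prod]
  exact Finset.prod_congr rfl fun t _ => simplexMeasure_real_singleton P (w t)

end MeasurableSpace

variable [DecidableEq S]

lemma sum_empirical_mul (T : ℕ+) (ξ : ℕ → S) (g : S → ℝ) :
    (T : ℝ) * ∑ i, (empirical T ξ).1 i * g i = ∑ t ∈ Finset.range T, g (ξ t) := by
  have hT : (T : ℝ) ≠ 0 := by positivity
  rw [Finset.mul_sum, ← Finset.sum_fiberwise_of_maps_to (t := Finset.univ) (g := ξ)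
    (fun _ _ => Finset.mem_univ _)]
  refine Finset.sum_congr rfl fun i _ => ?_
  rw [Finset.sum_congr rfl (g := fun _ => g i) (fun t ht => by rw [(Finset.mem_filter.1 ht).2])]
  simp only [empirical, Finset.sum_const, nsmul_eq_mul]
  field_simp

lemma empirical_congr {T : ℕ+} {ξ ζ : ℕ → S} (h : ∀ t ∈ Finset.range T, ξ t = ζ t) :
    empirical T ξ = empirical T ζ := by
  refine Subtype.ext (funext fun i => ?_)
  simp only [empirical]
  rw [Finset.filter_congr fun t ht => by rw [h t ht]]

variable [MeasurableSpace S] [MeasurableSingletonClass S]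

/-- Change of measure: a bound on the likelihood ratio on an event of the empirical distribution
carries over to the probabilities. -/
lemma sampleLaw_real_le_of_likelihood (P Q : Simplex S) (T : ℕ+) (A : Set (Simplex S)) (C : ℝ)
    (h : ∀ ξ : ℕ → S, empirical T ξ ∈ A →
      ∏ t ∈ Finset.range T, Q.1 (ξ t) ≤ C * ∏ t ∈ Finset.range T, P.1 (ξ t)) :
    (sampleLaw Q).real {ξ | empirical T ξ ∈ A} ≤ C * (sampleLaw P).real {ξ | empirical T ξ ∈ A} := by
  classical
  -- The event depends on the first `T` samples only, so both probabilities are sums over words of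
  -- length `T`, compared term by term.
  have : {ξ : ℕ → S | empirical T ξ ∈ A} =
      (Finset.range T).restrict ⁻¹' ((Finset.range T).restrict '' {ξ | empirical T ξ ∈ A}) := by
    refine Set.Subset.antisymm (Set.subset_preimage_image _ _) ?_
    rintro ξ ⟨ζ, hζ, h⟩
    rw [Set.mem_ofPred_eq] at hζ ⊢
    rwa [empirical_congr (ζ := ζ)]
    intro t ht
    exact (congrFun h ⟨t, ht⟩).symm
  rw [this, sampleLaw_real_restrict_preimage, sampleLaw_real_restrict_preimage, Finset.mul_sum]
  refine Finset.sum_le_sum fun w hw => ?_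
  obtain ⟨ξ, hξ, rfl⟩ := (Finset.mem_filter.1 hw).2
  simpa [← Finset.prod_coe_sort (Finset.range T)] using h ξ hξ

/-- The exponential Markov inequality for the empirical mean of `g`. -/
lemma sampleLaw_real_empirical_mean_ge_le (P : Simplex S) (g : S → ℝ) (T : ℕ+) {θ : ℝ}
    (hθ : 0 ≤ θ) (r : ℝ) :
    (sampleLaw P).real {ξ | r ≤ ∑ i, (empirical T ξ).1 i * g i} ≤
      Real.exp (-(T * (θ * r))) * (∑ i, P.1 i * Real.exp (θ * g i)) ^ (T : ℕ) := by
  classical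
  have hT : (0 : ℝ) < T := by positivity
  have hset : {ξ : ℕ → S | r ≤ ∑ i, (empirical T ξ).1 i * g i} =
      (Finset.range T).restrict ⁻¹' {w | T * r ≤ ∑ t, g (w t)} := by
    ext ξ
    simp only [Set.mem_ofPred_eq, Set.mem_preimage, Finset.restrict]
    rw [Finset.sum_coe_sort (Finset.range T) (fun t => g (ξ t)), ← sum_empirical_mul,
      mul_le_mul_iff_right₀ hT]
  have hpow : (∑ i, P.1 i * Real.exp (θ * g i)) ^ (T : ℕ) =
      ∑ w : Finset.range T → S, ∏ t, (P.1 (w t) * Real.exp (θ * g (w t))) := by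
    have := Finset.sum_prod_piFinset (ι := Finset.range T) (Finset.univ : Finset S)
      (fun _ i => P.1 i * Real.exp (θ * g i))
    rw [Fintype.piFinset_univ] at this
    rw [this]
    simp
  rw [hset, sampleLaw_real_restrict_preimage, hpow, Finset.mul_sum]
  refine (Finset.sum_le_sum fun w hw => ?_).trans
    (Finset.sum_le_sum_of_subset_of_nonneg (Finset.filter_subset _ _) fun w _ _ => ?_)
  · rw [Finset.prod_mul_distrib, ← Real.exp_sum, ← mul_assoc, mul_comm (Real.exp _), mul_assoc,
      ← Real.exp_add]
    -- On the event the exponential weight `exp (θ * ∑ g - T * θ * r)` is at least `1`; off it,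
    -- nonnegative terms are added.
    refine le_mul_of_one_le_right (Finset.prod_nonneg fun t _ => P.2.1 _) (Real.one_le_exp ?_)
    have := (Finset.mem_filter.1 hw).2
    rw [Set.mem_ofPred_eq] at this
    rw [← Finset.mul_sum]
    nlinarith [mul_le_mul_of_nonneg_left this hθ]
  · exact mul_nonneg (Real.exp_nonneg _)
      (Finset.prod_nonneg fun t _ => mul_nonneg (P.2.1 _) (Real.exp_nonneg _))

/-- Chernoff's bound at moderate deviations. -/
lemma sampleLaw_real_empirical_mean_ge_le_exp (P : Simplex S) (g : S → ℝ) (T : ℕ+) {θ M v : ℝ}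
    (hθ : 0 ≤ θ) (hM : ∀ i, |g i| ≤ M) (hθM : θ * M ≤ 1) (hg : ∑ i, P.1 i * g i = 0)
    (hv : ∑ i, P.1 i * g i ^ 2 ≤ v) (r : ℝ) :
    (sampleLaw P).real {ξ | r ≤ ∑ i, (empirical T ξ).1 i * g i} ≤
      Real.exp (-(T * (θ * r - θ ^ 2 * v / 2 - (θ * M) ^ 3))) := by
  refine (sampleLaw_real_empirical_mean_ge_le P g T hθ r).trans ?_
  have hmgf : ∑ i, P.1 i * Real.exp (θ * g i) ≤ Real.exp (θ ^ 2 * v / 2 + (θ * M) ^ 3) := by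
    have h1 : ∀ i ∈ Finset.univ, P.1 i * Real.exp (θ * g i) ≤
        P.1 i + θ * (P.1 i * g i) + θ ^ 2 / 2 * (P.1 i * g i ^ 2) + P.1 i * (θ * M) ^ 3 := by
      intro i _
      have habs : |θ * g i| ≤ θ * M := by
        rw [abs_mul, abs_of_nonneg hθ]; exact mul_le_mul_of_nonneg_left (hM i) hθ
      have h3 := pow_le_pow_left₀ (abs_nonneg (θ * g i)) habs 3
      have := mul_le_mul_of_nonneg_left
        ((Real.exp_le_quadratic_add_cube (habs.trans hθM)).trans (add_le_add_right h3 _)) (P.2.1 i)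
      refine this.trans_eq (by ring)
    refine (Finset.sum_le_sum h1).trans ?_
    rw [Finset.sum_add_distrib, Finset.sum_add_distrib, Finset.sum_add_distrib, ← Finset.mul_sum,
      ← Finset.mul_sum, ← Finset.sum_mul, P.2.2, hg]
    have h4 := Real.add_one_le_exp (θ ^ 2 * v / 2 + (θ * M) ^ 3)
    have := mul_le_mul_of_nonneg_left hv (show 0 ≤ θ ^ 2 / 2 by positivity)
    linarith
  have h0 : 0 ≤ ∑ i, P.1 i * Real.exp (θ * g i) :=
    Finset.sum_nonneg fun i _ => mul_nonneg (P.2.1 i) (Real.exp_nonneg _)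
  refine (mul_le_mul_of_nonneg_left (pow_le_pow_left₀ h0 hmgf T) (Real.exp_nonneg _)).trans_eq ?_
  rw [← Real.exp_nat_mul, ← Real.exp_add]
  congr 1
  ring

/-- The empirical distribution concentrates around the true one. -/
lemma sampleLaw_real_empirical_far_le (P : Simplex S) (T : ℕ+) {r : ℝ} (hr : 0 ≤ r) (hr1 : r ≤ 1) :
    (sampleLaw P).real {ξ | ∃ i, r ≤ |(empirical T ξ).1 i - P.1 i|} ≤
      Fintype.card S * (2 * Real.exp (-(T * (r ^ 2 / 8)))) := by
  have key : ∀ (i : S) (s : ℝ), |s| = 1 →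
      (sampleLaw P).real {ξ | r ≤ s * ((empirical T ξ).1 i - P.1 i)} ≤
        Real.exp (-(T * (r ^ 2 / 8))) := by
    intro i s hs
    have hs2 : s ^ 2 = 1 := by rw [← sq_abs, hs, one_pow]
    have hP1 : P.1 i ≤ 1 := by
      rw [← P.2.2]; exact Finset.single_le_sum (fun j _ => P.2.1 j) (Finset.mem_univ i)
    have hsum : ∀ Q : Simplex S, ∑ j, Q.1 j * (s * ((if j = i then 1 else 0) - P.1 i)) =
        s * (Q.1 i - P.1 i) := by
      intro Q
      have : ∀ j, Q.1 j * (s * ((if j = i then 1 else 0) - P.1 i)) =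
          s * (if j = i then Q.1 j else 0) - s * P.1 i * Q.1 j := by
        intro j; split_ifs <;> ring
      simp only [this, Finset.sum_sub_distrib, ← Finset.mul_sum, Q.2.2, Finset.sum_ite_eq',
        Finset.mem_univ, if_true]
      ring
    have hb : ∀ j, |s * ((if j = i then 1 else 0) - P.1 i)| ≤ 1 := by
      intro j
      rw [abs_mul, hs, one_mul, abs_le]
      have := P.2.1 i
      split_ifs <;> constructor <;> linarith
    have hv : ∑ j, P.1 j * (s * ((if j = i then 1 else 0) - P.1 i)) ^ 2 ≤ 1 := by
      refine (Finset.sum_le_sum fun j _ => ?_).trans_eq P.2.2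
      refine mul_le_of_le_one_right (P.2.1 j) ?_
      rw [sq_le_one_iff_abs_le_one]; exact hb j
    -- Centred indicators are bounded by `1` with variance at most `1`; `θ = r / 2` gives the
    -- exponent `3r²/8 - r³/8`, at least `r²/8` for `r ≤ 1`.
    have h := sampleLaw_real_empirical_mean_ge_le_exp P
      (fun j => s * ((if j = i then 1 else 0) - P.1 i)) T (θ := r / 2) (M := 1) (v := 1)
      (by linarith) hb (by linarith) (by rw [hsum]; simp) hv r
    simp only [hsum] at h
    refine h.trans (Real.exp_le_exp.2 (neg_le_neg (mul_le_mul_of_nonneg_left ?_ (by positivity))))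
    nlinarith [mul_nonneg (sq_nonneg r) (sub_nonneg.2 hr1), sq_nonneg r]
  have hsub : {ξ : ℕ → S | ∃ i, r ≤ |(empirical T ξ).1 i - P.1 i|} ⊆
      ⋃ i ∈ (Finset.univ : Finset S), ({ξ | r ≤ 1 * ((empirical T ξ).1 i - P.1 i)} ∪
        {ξ | r ≤ (-1) * ((empirical T ξ).1 i - P.1 i)}) := by
    rintro ξ ⟨i, hi⟩
    simp only [Finset.mem_univ, Set.iUnion_true, Set.mem_iUnion]
    refine ⟨i, ?_⟩
    rcases le_abs.1 hi with h | h
    · left; simpa using h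
    · right; simpa using h
  refine (measureReal_mono hsub (measure_ne_top _ _)).trans ((measureReal_biUnion_finset_le _ _).trans ?_)
  rw [← Finset.card_univ, ← nsmul_eq_mul]
  refine Finset.sum_le_card_nsmul _ _ _ fun i _ => ?_
  refine (measureReal_union_le _ _).trans ?_
  linarith [key i 1 (by simp), key i (-1) (by simp)]

end Sampling

/-! ### Calculus on the simplex along tangent directions. -/

section Simplex

variable {S : Type*} [Fintype S]

lemma continuous_simplex_apply (i : S) : Continuous fun P : Simplex S => P.1 i :=
  (continuous_apply i).comp continuous_subtype_val

/-- The functional with weights `w` in the coordinates given by `e`, linearly in `w`. -/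
noncomputable def weightFunctional {V : Type*} [NormedAddCommGroup V] [NormedSpace ℝ V]
    (e : V →L[ℝ] (S → ℝ)) : (S → ℝ) →L[ℝ] (V →L[ℝ] ℝ) :=
  ∑ i, (ContinuousLinearMap.proj i : (S → ℝ) →L[ℝ] ℝ).smulRight
    ((ContinuousLinearMap.proj i : (S → ℝ) →L[ℝ] ℝ).comp e)

/-- The functional on tangent directions with weights `w`. -/
noncomputable def tangentPairing (w : S → ℝ) : tangent S →L[ℝ] ℝ :=
  weightFunctional (tangent S).subtypeL w

lemma tangentPairing_apply (w : S → ℝ) (Δ : tangent S) :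
    tangentPairing w Δ = ∑ i, w i * Δ.1 i := by
  simp [tangentPairing, weightFunctional]

lemma mem_tangent_iff {Δ : S → ℝ} : Δ ∈ tangent S ↔ ∑ i, Δ i = 0 := Iff.rfl

lemma eventually_exists_interior {P : Simplex S} (hP : P ∈ simplexInterior S) :
    ∀ᶠ Δ : tangent S in 𝓝 0, ∃ Q ∈ simplexInterior S, P.1 + Δ.1 = Q.1 := by
  have h : ∀ i, ∀ᶠ Δ : tangent S in 𝓝 0, 0 < P.1 i + Δ.1 i := fun i => by
    have hc : Continuous fun Δ : tangent S => P.1 i + Δ.1 i :=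
      continuous_const.add ((continuous_apply i).comp continuous_subtype_val)
    exact hc.continuousAt.eventually (lt_mem_nhds (by simpa using hP i))
  filter_upwards [eventually_all.2 h] with Δ hΔ
  refine ⟨⟨P.1 + Δ.1, fun i => (hΔ i).le, ?_⟩, hΔ, rfl⟩
  simp [Finset.sum_add_distrib, P.2.2, mem_tangent_iff.1 Δ.2]

lemma localRep_eq (f : Simplex S → ℝ) {P Q : Simplex S} {Δ : tangent S} (h : P.1 + Δ.1 = Q.1) :
    localRep f P Δ = f Q := by
  rw [localRep, h, Subtype.val_injective.extend_apply]

lemma localRep_add (f : Simplex S → ℝ) {P Q : Simplex S} {Δ : tangent S} (h : P.1 + Δ.1 = Q.1)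
    (Δ' : tangent S) : localRep f P (Δ + Δ') = localRep f Q Δ' := by
  simp only [localRep, ← h, Submodule.coe_add, add_assoc]

/-- The derivative on the simplex of a function that is differentiable on the whole space. -/
lemma hasFDerivAt_localRep {f : Simplex S → ℝ} {F : (S → ℝ) → ℝ} {F' : (S → ℝ) →L[ℝ] ℝ}
    {P : Simplex S} (hP : P ∈ simplexInterior S) (hf : ∀ Q : Simplex S, f Q = F Q.1)
    (hF : HasFDerivAt F F' P.1) :
    HasFDerivAt (localRep f P) (F'.comp (tangent S).subtypeL) 0 := by
  have h1 : HasFDerivAt (fun Δ : tangent S => P.1 + Δ.1) (tangent S).subtypeL 0 :=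
    (tangent S).subtypeL.hasFDerivAt.const_add P.1
  have h2 : HasFDerivAt (fun Δ : tangent S => F (P.1 + Δ.1)) (F'.comp (tangent S).subtypeL) 0 :=
    HasFDerivAt.comp (0 : tangent S) (by simpa using hF) h1
  refine h2.congr_of_eventuallyEq ?_
  filter_upwards [eventually_exists_interior hP] with Δ ⟨Q, _, hQ⟩
  rw [localRep_eq f hQ, hf, hQ]

end Simplex

/-! ### The variance of the loss and the derivative of its square root. -/

section Variance

variable {X S : Type*} [Fintype S] (l : X → S → ℝ) (x : X)

lemma cost_eq_add_tangentPairing {P Q : Simplex S} {Δ : tangent S}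
    (h : P.1 + Δ.1 = Q.1) : cost l x Q = cost l x P + tangentPairing (l x) Δ := by
  rw [tangentPairing_apply, cost, cost, ← h, ← Finset.sum_add_distrib]
  exact Finset.sum_congr rfl fun i _ => by simp only [Pi.add_apply]; ring

lemma sum_mul_sub_cost (P : Simplex S) : ∑ i, P.1 i * (l x i - cost l x P) = 0 := by
  simp only [mul_sub, Finset.sum_sub_distrib, ← Finset.sum_mul, P.2.2, one_mul]
  exact sub_self _

lemma sum_mul_sub_const (P : Simplex S) (k : ℝ) : ∑ i, P.1 i * (l x i - k) = cost l x P - k := by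
  simp only [mul_sub, Finset.sum_sub_distrib, ← Finset.sum_mul, P.2.2, one_mul]
  rfl

lemma lossVar_nonneg (P : Simplex S) : 0 ≤ lossVar l x P :=
  Finset.sum_nonneg fun i _ => mul_nonneg (P.2.1 i) (sq_nonneg _)

/-- The variance in terms of the deviations from an arbitrary centre. -/
lemma lossVar_eq_sub_sq (P : Simplex S) (k : ℝ) :
    lossVar l x P = ∑ i, P.1 i * (l x i - k) ^ 2 - (∑ i, P.1 i * (l x i - k)) ^ 2 := by
  have h : ∀ i, P.1 i * (l x i - cost l x P) ^ 2 = P.1 i * (l x i - k) ^ 2 -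
      2 * (cost l x P - k) * (P.1 i * (l x i - k)) + (cost l x P - k) ^ 2 * P.1 i := fun i => by
    ring
  rw [lossVar]
  simp only [h, Finset.sum_add_distrib, Finset.sum_sub_distrib, ← Finset.mul_sum, P.2.2]
  rw [sum_mul_sub_const]
  ring

lemma mul_sq_sub_cost_le_lossVar (P : Simplex S) (i : S) :
    P.1 i * (l x i - cost l x P) ^ 2 ≤ lossVar l x P :=
  Finset.single_le_sum (f := fun i => P.1 i * (l x i - cost l x P) ^ 2)
    (fun j _ => mul_nonneg (P.2.1 j) (sq_nonneg _)) (Finset.mem_univ i)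

lemma eq_cost_of_lossVar_eq_zero {P : Simplex S} {i : S} (hi : 0 < P.1 i)
    (h : lossVar l x P = 0) : l x i = cost l x P := by
  have h1 := mul_sq_sub_cost_le_lossVar l x P i
  rw [h] at h1
  have h2 : (l x i - cost l x P) ^ 2 ≤ 0 := by
    by_contra hc
    exact absurd h1 (not_le.2 (mul_pos hi (not_le.1 hc)))
  exact sub_eq_zero.1 (pow_eq_zero_iff two_ne_zero |>.1 (le_antisymm h2 (sq_nonneg _)))

/-- The weights of the derivative of the standard deviation of the loss. -/
noncomputable def stdDerivWeight (y : X × Simplex S) : S → ℝ :=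
  fun i => (l y.1 i - cost l y.1 y.2) ^ 2 / (2 * Real.sqrt (lossVar l y.1 y.2))

/-- If the variance vanishes at an interior `P`, the loss is constant on `S`, so the standard
deviation vanishes on the whole simplex; the weights, read as division by `0`, are then `0` as well.
Otherwise the chain rule for the square root applies. -/
lemma hasFDerivAt_localRep_cost_add_std {P : Simplex S} (hP : P ∈ simplexInterior S) (k : ℝ) :
    HasFDerivAt (localRep (fun Q => cost l x Q + k * Real.sqrt (lossVar l x Q)) P)
      (tangentPairing (l x) + k • tangentPairing (stdDerivWeight l (x, P))) 0 := by
  let dot : (S → ℝ) → (S → ℝ) →L[ℝ] ℝ := fun w => ∑ i, w i • ContinuousLinearMap.proj i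
  have hdot : ∀ w p, dot w p = ∑ i, p i * w i := fun w p => by
    simp [dot, mul_comm]
  have hpair : ∀ w, (dot w).comp (tangent S).subtypeL = tangentPairing w := fun w => by
    ext Δ
    rw [ContinuousLinearMap.comp_apply, hdot, tangentPairing_apply]
    simp [mul_comm]
  rcases (lossVar_nonneg l x P).eq_or_lt with h0 | hpos
  · have hc : ∀ i, l x i = cost l x P := fun i => eq_cost_of_lossVar_eq_zero l x (hP i) h0.symm
    have hw : stdDerivWeight l (x, P) = 0 := by
      ext i; simp [stdDerivWeight, ← h0]
    have hV : ∀ Q : Simplex S, lossVar l x Q = 0 := fun Q => by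
      rw [lossVar_eq_sub_sq l x Q (cost l x P)]; simp [hc]
    rw [hw, tangentPairing, tangentPairing, map_zero, smul_zero, add_zero, ← tangentPairing, ← hpair]
    refine hasFDerivAt_localRep hP (F := dot (l x)) (fun Q => ?_) (dot (l x)).hasFDerivAt
    rw [hV, hdot, cost]; simp
  · set c := cost l x P
    -- Centring at the cost of the fixed `P` kills the derivative of the squared-mean term at `P`,
    -- leaving a linear functional with weights `u i ^ 2`.
    let u : S → ℝ := fun i => l x i - c
    have hu : dot u P.1 = 0 := by rw [hdot]; exact sum_mul_sub_cost l x P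
    have hVF : ∀ Q : Simplex S,
        lossVar l x Q = dot (fun i => u i ^ 2) Q.1 - dot u Q.1 ^ 2 := fun Q => by
      rw [hdot, hdot]; exact lossVar_eq_sub_sq l x Q c
    have hV : HasFDerivAt (fun p => dot (fun i => u i ^ 2) p - dot u p ^ 2)
        (dot fun i => u i ^ 2) P.1 := by
      have := (dot fun i => u i ^ 2).hasFDerivAt (x := P.1) |>.sub
        (((dot u).hasFDerivAt (x := P.1)).pow 2)
      rw [hu, zero_pow (by norm_num), smul_zero, zero_smul, sub_zero] at this
      exact this
    have hF := ((dot (l x)).hasFDerivAt (x := P.1)).add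
      ((hV.sqrt (by rw [← hVF]; exact hpos.ne')).const_smul k)
    convert hasFDerivAt_localRep hP
      (f := fun Q => cost l x Q + k * Real.sqrt (lossVar l x Q)) (fun Q => ?_) hF using 1
    · rw [ContinuousLinearMap.add_comp, hpair, ContinuousLinearMap.smul_comp,
        ContinuousLinearMap.smul_comp, hpair]
      congr 2
      rw [tangentPairing, tangentPairing, ← map_smul]
      congr 1
      funext i
      simp only [stdDerivWeight, ← hVF P, Pi.smul_apply, smul_eq_mul, u, c]
      rw [one_div, div_eq_inv_mul]
    · simp only [Pi.add_apply, Pi.smul_apply, smul_eq_mul, hdot]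
      rw [hVF Q]
      simp [cost, hdot]

lemma svp_eq {a : ℕ+ → ℝ} (ha : ∀ T, 0 ≤ a T) (T : ℕ+) (P : Simplex S) :
    svp l a T x P =
      cost l x P + Real.sqrt (2 * a T / (T : ℝ)) * Real.sqrt (lossVar l x P) := by
  rw [svp, Real.sqrt_mul]
  have := ha T
  positivity

end Variance

lemma PNat.exists_bound_of_tendsto {u : ℕ+ → ℝ} {c : ℝ} (h : Tendsto u atTop (𝓝 c)) :
    ∃ K, ∀ T, |u T| ≤ K := by
  have h' : Tendsto (fun n : ℕ => u n.succPNat) atTop (𝓝 c) :=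
    h.comp (tendsto_atTop_mono (fun n => (PNat.coe_le_coe _ _).1 (by simp))
      (tendsto_atTop_atTop.2 fun b => ⟨b, fun n hn => (PNat.coe_le_coe _ _).1 (by simp; omega)⟩ :
        Tendsto Nat.succPNat atTop atTop))
  obtain ⟨K, hK⟩ := (Metric.isBounded_range_of_tendsto _ h').exists_norm_le
  refine ⟨K, fun T => hK _ ⟨T.natPred, ?_⟩⟩
  simp


/-! ### Continuity of cost, variance and derivative weights; families with bounded scalars. -/

section Continuity

variable {X S : Type*} [TopologicalSpace X] [Fintype S] {l : X → S → ℝ}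

lemma continuous_cost (hl : ∀ i, Continuous fun x => l x i) :
    Continuous fun y : X × Simplex S => cost l y.1 y.2 := by
  unfold cost
  have : ∀ i, Continuous fun y : X × Simplex S => l y.1 i := fun i => (hl i).comp continuous_fst
  have (i : S) : Continuous fun y : X × Simplex S => y.2.1 i :=
    (continuous_simplex_apply i).comp continuous_snd
  fun_prop

lemma continuous_lossVar (hl : ∀ i, Continuous fun x => l x i) :
    Continuous fun y : X × Simplex S => lossVar l y.1 y.2 := by
  unfold lossVar
  have : ∀ i, Continuous fun y : X × Simplex S => l y.1 i := fun i => (hl i).comp continuous_fst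
  have (i : S) : Continuous fun y : X × Simplex S => y.2.1 i :=
    (continuous_simplex_apply i).comp continuous_snd
  have := continuous_cost hl
  fun_prop

/-- At zero variance the weight is an apparent `0 / 0`. Since `P i * (l i - cost)² ≤ Var`, it is at
most `|l i - cost| / (2 * √(P i))`, which tends to `0` because `P i` stays away from `0`. -/
lemma continuousAt_stdDerivWeight (hl : ∀ i, Continuous fun x => l x i) {y : X × Simplex S}
    (hy : y.2 ∈ simplexInterior S) : ContinuousAt (stdDerivWeight l) y := by
  refine continuousAt_pi.2 fun i => ?_
  have hu : Continuous fun y : X × Simplex S => l y.1 i - cost l y.1 y.2 :=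
    ((hl i).comp continuous_fst).sub (continuous_cost hl)
  have hV := continuous_lossVar hl
  by_cases h0 : lossVar l y.1 y.2 = 0
  · have hval : stdDerivWeight l y i = 0 := by simp [stdDerivWeight, h0]
    have hP : Continuous fun y : X × Simplex S => y.2.1 i :=
      (continuous_simplex_apply i).comp continuous_snd
    have hlim : Tendsto (fun z : X × Simplex S =>
        |l z.1 i - cost l z.1 z.2| / (2 * Real.sqrt (z.2.1 i))) (𝓝 y) (𝓝 0) := by
      have hne : 2 * Real.sqrt (y.2.1 i) ≠ 0 := by
        have := Real.sqrt_pos.2 (hy i); positivity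
      have hc : ContinuousAt (fun z : X × Simplex S =>
          |l z.1 i - cost l z.1 z.2| / (2 * Real.sqrt (z.2.1 i))) y :=
        hu.abs.continuousAt.div (by fun_prop) hne
      have := hc.tendsto
      rwa [eq_cost_of_lossVar_eq_zero l y.1 (hy i) h0, sub_self, abs_zero, zero_div] at this
    rw [ContinuousAt, hval]
    refine squeeze_zero' (Eventually.of_forall fun z => by unfold stdDerivWeight; positivity) ?_ hlim
    filter_upwards [hP.continuousAt.eventually (lt_mem_nhds (hy i))] with z hz
    have hsP := Real.sqrt_pos.2 hz
    have hle : Real.sqrt (z.2.1 i) * |l z.1 i - cost l z.1 z.2| ≤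
        Real.sqrt (lossVar l z.1 z.2) := by
      refine Real.le_sqrt_of_sq_le ?_
      rw [mul_pow, Real.sq_sqrt hz.le, sq_abs]
      exact mul_sq_sub_cost_le_lossVar l z.1 z.2 i
    rcases (Real.sqrt_nonneg (lossVar l z.1 z.2)).eq_or_lt with h | h
    · rw [stdDerivWeight, ← h]; simp; positivity
    · rw [stdDerivWeight, div_le_div_iff₀ (by positivity) (by positivity), ← sq_abs]
      nlinarith [mul_le_mul_of_nonneg_left hle (abs_nonneg (l z.1 i - cost l z.1 z.2))]
  · exact (hu.pow 2).continuousAt.div (by fun_prop)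
      (by have := Real.sqrt_pos.2 ((lossVar_nonneg l y.1 y.2).lt_of_ne' h0); positivity)

/-- A family `H + k T • G` with bounded scalars `k T` is equicontinuous where `G`, `H` are
continuous. -/
lemma equicontinuousWithinAt_add_smul {Y ι E : Type*} [TopologicalSpace Y] [SeminormedAddCommGroup E]
    [NormedSpace ℝ E] {H G : Y → E} {k : ι → ℝ} {K : ℝ} (hk : ∀ T, |k T| ≤ K) {s : Set Y} {y : Y}
    (hH : ContinuousWithinAt H s y) (hG : ContinuousWithinAt G s y) :
    EquicontinuousWithinAt (fun T z => H z + k T • G z) s y := by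
  rw [Metric.uniformity_basis_dist.equicontinuousWithinAt_iff_right]
  intro ε hε
  have hlim : Tendsto (fun z => ‖H y - H z‖ + K * ‖G y - G z‖) (𝓝[s] y) (𝓝 0) := by
    have := (((tendsto_const_nhds (x := H y)).sub hH.tendsto).norm).add
      ((((tendsto_const_nhds (x := G y)).sub hG.tendsto).norm).const_mul K)
    simpa using this
  filter_upwards [hlim.eventually (gt_mem_nhds hε)] with z hz T
  refine lt_of_le_of_lt ?_ hz
  change dist _ _ ≤ _
  rw [dist_eq_norm, show H y + k T • G y - (H z + k T • G z) = (H y - H z) + k T • (G y - G z) by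
    rw [smul_sub]; abel]
  refine (norm_add_le _ _).trans (add_le_add_right ?_ _)
  rw [norm_smul]
  exact mul_le_mul_of_nonneg_right (hk T) (norm_nonneg _)

lemma IsCompact.exists_bound_add_smul {Y ι E : Type*} [TopologicalSpace Y]
    [SeminormedAddCommGroup E] [NormedSpace ℝ E] {H G : Y → E} {k : ι → ℝ} {K : ℝ}
    (hk : ∀ T, |k T| ≤ K) {s : Set Y} (hs : IsCompact s) (hH : ContinuousOn H s)
    (hG : ContinuousOn G s) : ∃ C, ∀ T, ∀ y ∈ s, ‖H y + k T • G y‖ ≤ C := by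
  obtain ⟨C₁, h₁⟩ := hs.exists_bound_of_continuousOn hH
  obtain ⟨C₂, h₂⟩ := hs.exists_bound_of_continuousOn hG
  refine ⟨C₁ + K * C₂, fun T y hy => (norm_add_le _ _).trans (add_le_add (h₁ y hy) ?_)⟩
  rw [norm_smul]
  exact mul_le_mul (hk T) (h₂ y hy) (norm_nonneg _) ((abs_nonneg _).trans (hk T))

end Continuity

/-! ### Regularity of the variance predictor. -/

section Regularity

variable {X S : Type*} [TopologicalSpace X] [CompactSpace X] [Fintype S] {l : X → S → ℝ}

theorem svp_regular (hl : ∀ i, Continuous fun x => l x i) {a : ℕ+ → ℝ} (ha : ∀ T, 0 ≤ a T)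
    (ha_sub : Tendsto (fun T : ℕ+ => a T / (T : ℝ)) atTop (𝓝 0)) :
    RegularPredictor (svp l a) := by
  obtain ⟨K, hK⟩ : ∃ K, ∀ T : ℕ+, |Real.sqrt (2 * a T / (T : ℝ))| ≤ K := by
    refine PNat.exists_bound_of_tendsto (c := 0) ?_
    have := (ha_sub.const_mul 2).sqrt
    simpa [mul_div_assoc] using this
  have hcost := continuous_cost hl
  have hstd : Continuous fun y : X × Simplex S => Real.sqrt (lossVar l y.1 y.2) :=
    (continuous_lossVar hl).sqrt
  have hderiv : ∀ (T : ℕ+) (x : X), ∀ P ∈ simplexInterior S,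
      HasFDerivAt (localRep (svp l a T x) P) (tangentPairing (l x) +
        Real.sqrt (2 * a T / (T : ℝ)) • tangentPairing (stdDerivWeight l (x, P))) 0 := by
    intro T x P hP
    have := hasFDerivAt_localRep_cost_add_std l x hP (Real.sqrt (2 * a T / (T : ℝ)))
    rwa [show svp l a T x = _ from funext fun Q => svp_eq l x ha T Q]
  have hH : Continuous fun y : X × Simplex S => l y.1 :=
    continuous_pi fun i => (hl i).comp continuous_fst
  refine ⟨?_, ?_, fun T x P hP => (hderiv T x P hP).differentiableAt, ?_, ?_⟩
  · obtain ⟨C, hC⟩ := isCompact_univ.exists_bound_add_smul hK hcost.continuousOn hstd.continuousOn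
    refine ⟨C, fun T x P => ?_⟩
    rw [svp_eq l _ ha]
    exact hC T (x, P) (Set.mem_univ _)
  · rw [← equicontinuousOn_univ]
    intro y _
    have := equicontinuousWithinAt_add_smul hK (s := Set.univ) (y := y)
      hcost.continuousWithinAt hstd.continuousWithinAt
    simpa only [svp_eq l _ ha, smul_eq_mul] using this
  · intro Q hQ hQi
    have hW := (weightFunctional (tangent S).subtypeL).continuous
    obtain ⟨C, hC⟩ := ((isCompact_univ (X := X)).prod hQ).exists_bound_add_smul hK
      (hW.comp_continuousOn hH.continuousOn) (hW.comp_continuousOn fun y hy =>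
        (continuousAt_stdDerivWeight hl (hQi hy.2)).continuousWithinAt)
    refine ⟨C, fun T x P hP => ?_⟩
    rw [simplexDeriv, (hderiv T x P (hQi hP)).fderiv]
    exact hC T (x, P) ⟨Set.mem_univ _, hP⟩
  · intro y hy
    have hW := (weightFunctional (tangent S).subtypeL).continuous
    have := equicontinuousWithinAt_add_smul hK (s := Set.univ ×ˢ simplexInterior S) (y := y)
      (hW.continuousAt.comp_continuousWithinAt hH.continuousWithinAt)
      (hW.continuousAt.comp_continuousWithinAt
        (continuousAt_stdDerivWeight hl hy.2).continuousWithinAt)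
    intro U hU
    filter_upwards [this U hU, self_mem_nhdsWithin] with z hz hzs T
    rw [simplexDeriv, simplexDeriv, (hderiv T y.1 y.2 hy.2).fderiv,
      (hderiv T z.1 z.2 hzs.2).fderiv]
    exact hz T

end Regularity

/-! ### Logarithmic rates versus exponential bounds. -/

section LogRates

/-- The prefactor contributes `log C / a T → 0`, so constants do not affect the rate. -/
lemma limsup_log_rate_le {a : ℕ+ → ℝ} (ha_top : Tendsto a atTop atTop) {μ : ℕ+ → ℝ≥0∞}
    (h : ∀ q : ℝ, 0 < q → q < 1 → ∃ C : ℝ, 0 < C ∧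
      ∀ᶠ T in atTop, μ T ≤ ENNReal.ofReal (C * Real.exp (-(q * a T)))) :
    limsup (fun T => ((1 / a T : ℝ) : EReal) * ENNReal.log (μ T)) atTop ≤ -1 := by
  refine EReal.le_of_forall_lt_iff_le.1 fun z hz => ?_
  have hz' : -1 < z := EReal.coe_lt_coe_iff.1 (by simpa using hz)
  obtain ⟨q, hq, hq1⟩ := exists_between (show max 0 (-z) < 1 from max_lt one_pos (by linarith))
  obtain ⟨C, hC, hμ⟩ := h q ((le_max_left _ _).trans_lt hq) hq1
  refine limsup_le_of_le (h := ?_)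
  have hlim : Tendsto (fun T => Real.log C / a T - q) atTop (𝓝 (0 - q)) :=
    (ha_top.const_div_atTop _).sub_const q
  have hqz : 0 - q < z := by linarith [(le_max_right 0 (-z)).trans_lt hq]
  filter_upwards [hμ, ha_top.eventually_gt_atTop 0, hlim.eventually (gt_mem_nhds hqz)]
    with T hT ha hlt
  have h1 : ENNReal.log (μ T) ≤ ((Real.log C - q * a T : ℝ) : EReal) := by
    refine (ENNReal.log_monotone hT).trans_eq ?_
    rw [ENNReal.log_ofReal_of_pos (by positivity), Real.log_mul hC.ne' (Real.exp_ne_zero _),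
      Real.log_exp]
    rfl
  have h0 : (0 : EReal) ≤ ((1 / a T : ℝ) : EReal) := by exact_mod_cast (by positivity)
  refine (mul_le_mul_of_nonneg_left h1 h0).trans ?_
  rw [← EReal.coe_mul, EReal.coe_le_coe_iff]
  refine le_of_eq_of_le ?_ hlt.le
  field_simp

lemma eventually_le_exp_of_limsup_log_rate_le {a : ℕ+ → ℝ} (ha_top : Tendsto a atTop atTop)
    {μ : ℕ+ → ℝ≥0∞}
    (h : limsup (fun T => ((1 / a T : ℝ) : EReal) * ENNReal.log (μ T)) atTop ≤ -1)
    {q : ℝ} (hq : q < 1) : ∀ᶠ T in atTop, μ T ≤ ENNReal.ofReal (Real.exp (-(q * a T))) := by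
  have hlt : limsup (fun T => ((1 / a T : ℝ) : EReal) * ENNReal.log (μ T)) atTop
      < ((-q : ℝ) : EReal) := by
    refine lt_of_le_of_lt h ?_
    have : ((-1 : ℝ) : EReal) < ((-q : ℝ) : EReal) := EReal.coe_lt_coe_iff.2 (by linarith)
    simpa using this
  filter_upwards [eventually_lt_of_limsup_lt hlt, ha_top.eventually_gt_atTop 0] with T hT ha
  by_contra hc
  rw [not_le, ← ENNReal.log_lt_log_iff, ENNReal.log_ofReal_of_pos (Real.exp_pos _),
    Real.log_exp] at hc
  have h0 : (0 : EReal) ≤ ((1 / a T : ℝ) : EReal) := by exact_mod_cast (by positivity)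
  have := mul_le_mul_of_nonneg_left hc.le h0
  rw [← EReal.coe_mul, show 1 / a T * -(q * a T) = -q by field_simp] at this
  exact absurd hT (not_lt.2 this)

end LogRates

lemma simplex_dist_lt_iff {S : Type*} [Fintype S] {P Q : Simplex S} {r : ℝ} (hr : 0 < r) :
    dist P Q < r ↔ ∀ i, |P.1 i - Q.1 i| < r := by
  rw [Subtype.dist_eq, dist_pi_lt_iff hr]
  rfl

/-! ### The guarantee of the variance predictor. -/

section Guarantee

variable {X S : Type*} [Fintype S] [DecidableEq S] [MeasurableSpace S]

lemma disappointment_eq_ofReal (l : X → S → ℝ) (c : Predictor X S) (x : X) (P : Simplex S)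
    (T : ℕ+) : disappointment l c x P T =
      ENNReal.ofReal ((sampleLaw P).real {ξ | empirical T ξ ∈ {Q | cost l x P > c T x Q}}) := by
  rw [ofReal_measureReal]; rfl

variable [MeasurableSingletonClass S]

/-- With zero variance the loss is constant on the support of `P`, so the empirical cost of any
sample of positive likelihood is the true cost. -/
lemma disappointment_svp_eq_zero (l : X → S → ℝ) {a : ℕ+ → ℝ} {x : X} {P : Simplex S}
    (h0 : lossVar l x P = 0) (T : ℕ+) : disappointment l (svp l a) x P T = 0 := by
  rw [disappointment_eq_ofReal, ENNReal.ofReal_eq_zero]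
  -- Change of measure from `P` to itself with constant `0`: it suffices that every path in the
  -- event has likelihood `0`.
  refine (sampleLaw_real_le_of_likelihood P P T _ 0 fun ξ hξ => ?_).trans_eq (zero_mul _)
  rw [zero_mul]
  by_contra hpos
  have hP : ∀ t ∈ Finset.range T, 0 < P.1 (ξ t) := fun t ht =>
    (P.2.1 _).lt_of_ne' (Finset.prod_ne_zero_iff.1 (not_le.1 hpos).ne' t ht)
  have hcost : cost l x (empirical T ξ) = cost l x P := by
    have hT : (T : ℝ) ≠ 0 := by positivity
    refine mul_left_cancel₀ hT ?_
    rw [cost, sum_empirical_mul, Finset.sum_congr rfl fun t ht =>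
      eq_cost_of_lossVar_eq_zero l x (hP t ht) h0]
    simp
  have hξ' : cost l x P > svp l a T x (empirical T ξ) := hξ
  rw [svp, hcost] at hξ'
  linarith [Real.sqrt_nonneg (2 * a T / (T : ℝ) * lossVar l x (empirical T ξ))]

theorem svp_guarantee (l : X → S → ℝ) {a : ℕ+ → ℝ} (ha : ∀ T, 0 ≤ a T)
    (ha_top : Tendsto a atTop atTop)
    (ha_sub : Tendsto (fun T : ℕ+ => a T / (T : ℝ)) atTop (𝓝 0)) :
    OutOfSampleGuarantee l a (svp l a) Set.univ := by
  intro x P _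
  refine limsup_log_rate_le ha_top fun q hq0 hq1 => ?_
  rcases (lossVar_nonneg l x P).eq_or_lt with h0 | hpos
  · exact ⟨1, one_pos, Eventually.of_forall fun T => by
      rw [disappointment_svp_eq_zero l h0.symm]; exact zero_le⟩
  set v := lossVar l x P
  obtain ⟨p, hqp, hp1⟩ := exists_between hq1
  have hp0 : 0 < p := hq0.trans hqp
  let g : S → ℝ := fun i => cost l x P - l x i
  obtain ⟨M, hM⟩ : ∃ M, ∀ i, |g i| ≤ M :=
    ⟨∑ i, |g i|, fun i => Finset.single_le_sum (f := fun i => |g i|) (fun j _ => abs_nonneg _)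
      (Finset.mem_univ i)⟩
  have hsum : ∀ Q : Simplex S, ∑ i, Q.1 i * g i = cost l x P - cost l x Q := fun Q => by
    simp only [g, mul_sub, Finset.sum_sub_distrib, ← Finset.sum_mul, Q.2.2, one_mul]
    rfl
  have hg2 : ∑ i, P.1 i * g i ^ 2 = v :=
    Finset.sum_congr rfl fun i _ => by simp only [g]; ring
  obtain ⟨η, hη0, hη⟩ : ∃ η > 0, ∀ Q : Simplex S, dist Q P < η → p * v < lossVar l x Q := by
    have hc : Continuous fun Q : Simplex S => lossVar l x Q := by
      have h := continuous_simplex_apply (S := S)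
      exact continuous_finsetSum _ fun i _ => (h i).mul ((continuous_const.sub
        (continuous_finsetSum _ fun j _ => (h j).mul continuous_const)).pow 2)
    exact Metric.eventually_nhds_iff.1
      (hc.continuousAt.eventually (lt_mem_nhds (show p * v < v by nlinarith)))
  obtain ⟨η', hη'0, hη'⟩ := exists_between (lt_min hη0 one_pos)
  -- The least penalty while the empirical variance exceeds `p * v`. The Chernoff parameter `θ = r T
  -- / v` optimises the quadratic part of the exponent, with value `T * r T ^ 2 / (2 * v) = p * a
  -- T`; the slack `q < p` absorbs the cubic error.
  let r : ℕ+ → ℝ := fun T => Real.sqrt (2 * a T / (T : ℝ) * (p * v))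
  have hr : Tendsto r atTop (𝓝 0) := by
    have := ((ha_sub.const_mul 2).mul_const (p * v)).sqrt
    simpa [r, mul_div_assoc] using this
  have hθ : Tendsto (fun T => r T / v * M) atTop (𝓝 0) := by
    simpa using (hr.div_const v).mul_const M
  have hrate : Tendsto (fun T => p * (1 - 2 * r T * M ^ 3 / v ^ 2)) atTop (𝓝 p) := by
    simpa using ((((hr.const_mul 2).mul_const (M ^ 3)).div_const (v ^ 2)).const_sub 1).const_mul p
  have hsmall : Tendsto (fun T : ℕ+ => q * (a T / (T : ℝ))) atTop (𝓝 0) := by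
    simpa using ha_sub.const_mul q
  refine ⟨1 + Fintype.card S * 2, by positivity, ?_⟩
  filter_upwards [hθ.eventually (gt_mem_nhds one_pos), hrate.eventually (lt_mem_nhds hqp),
    hsmall.eventually (gt_mem_nhds (show 0 < η' ^ 2 / 8 by positivity))] with T hT1 hT2 hT3
  have hTpos : (0 : ℝ) < T := by positivity
  have haT := ha T
  have hr0 : 0 ≤ r T := Real.sqrt_nonneg _
  have hr2 : (T : ℝ) * r T ^ 2 = 2 * a T * (p * v) := by
    simp only [r]
    rw [Real.sq_sqrt (by positivity)]
    field_simp
  rw [disappointment_eq_ofReal]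
  refine ENNReal.ofReal_le_ofReal ?_
  have hsub : {ξ : ℕ → S | empirical T ξ ∈ {Q | cost l x P > svp l a T x Q}} ⊆
      {ξ | r T ≤ ∑ i, (empirical T ξ).1 i * g i} ∪
        {ξ | ∃ i, η' ≤ |(empirical T ξ).1 i - P.1 i|} := by
    intro ξ hξ
    have hξ' : cost l x P > svp l a T x (empirical T ξ) := hξ
    by_cases hfar : ∃ i, η' ≤ |(empirical T ξ).1 i - P.1 i|
    · exact Or.inr hfar
    · left
      push Not at hfar
      have hv := hη (empirical T ξ)
        (((simplex_dist_lt_iff hη'0).2 hfar).trans (hη'.trans_le (min_le_left _ _)))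
      rw [Set.mem_ofPred_eq, hsum]
      rw [svp] at hξ'
      have : r T ≤ Real.sqrt (2 * a T / (T : ℝ) * lossVar l x (empirical T ξ)) :=
        Real.sqrt_le_sqrt (mul_le_mul_of_nonneg_left hv.le (by positivity))
      linarith
  refine (measureReal_mono hsub (measure_ne_top _ _)).trans ((measureReal_union_le _ _).trans ?_)
  have h1 : (sampleLaw P).real {ξ | r T ≤ ∑ i, (empirical T ξ).1 i * g i} ≤
      Real.exp (-(q * a T)) := by
    refine (sampleLaw_real_empirical_mean_ge_le_exp P g T (θ := r T / v) (by positivity) hM hT1.le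
      (by rw [hsum, sub_self]) hg2.le (r T)).trans (Real.exp_le_exp.2 (neg_le_neg ?_))
    have : (T : ℝ) * (r T / v * r T - (r T / v) ^ 2 * v / 2 - (r T / v * M) ^ 3) =
        (p * (1 - 2 * r T * M ^ 3 / v ^ 2)) * a T := by
      have : (T : ℝ) * (r T / v * r T - (r T / v) ^ 2 * v / 2 - (r T / v * M) ^ 3) =
          (T * r T ^ 2) * (1 / (2 * v) - r T * M ^ 3 / v ^ 3) := by
        field_simp
        ring
      rw [this, hr2]
      field_simp
    rw [this]
    exact mul_le_mul_of_nonneg_right hT2.le haT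
  have h2 := sampleLaw_real_empirical_far_le P T hη'0.le (hη'.le.trans (min_le_right _ _))
  -- Subexponential speed: `q * a T` is eventually below any fixed multiple of `T`.
  have h3 : Real.exp (-((T : ℝ) * (η' ^ 2 / 8))) ≤ Real.exp (-(q * a T)) := by
    refine Real.exp_le_exp.2 (neg_le_neg ?_)
    have := mul_le_mul_of_nonneg_left hT3.le hTpos.le
    refine le_of_eq_of_le ?_ this
    field_simp
  have h4 : (Fintype.card S : ℝ) * (2 * Real.exp (-((T : ℝ) * (η' ^ 2 / 8)))) ≤
      Fintype.card S * (2 * Real.exp (-(q * a T))) := by gcongr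
  linarith

end Guarantee

/-! ### Expansion of regular predictors uniformly in the sample size. -/

section Taylor

lemma EquicontinuousWithinAt.eventually_norm_sub_lt {Y ι E : Type*} [TopologicalSpace Y]
    [SeminormedAddCommGroup E] {F : ι → Y → E} {s : Set Y} {y : Y}
    (h : EquicontinuousWithinAt F s y) {ε : ℝ} (hε : 0 < ε) :
    ∀ᶠ z in 𝓝[s] y, ∀ i, ‖F i z - F i y‖ < ε := by
  filter_upwards [Metric.uniformity_basis_dist.equicontinuousWithinAt_iff_right.1 h ε hε]
    with z hz i
  rw [← dist_eq_norm, dist_comm]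
  exact hz i

variable {X S : Type*} [TopologicalSpace X] [Fintype S]

lemma dist_eq_norm_of_add_eq {P Q : Simplex S} {Δ : tangent S} (h : P.1 + Δ.1 = Q.1) :
    dist Q P = ‖Δ‖ := by
  rw [Subtype.dist_eq, dist_eq_norm, ← h, add_sub_cancel_left]
  rfl

lemma hasFDerivAt_localRep_of_add_eq {f : Simplex S → ℝ} {P Q : Simplex S} {Δ : tangent S}
    (h : P.1 + Δ.1 = Q.1) (hf : SimplexDifferentiableAt f Q) :
    HasFDerivAt (localRep f P) (simplexDeriv f Q) Δ := by
  have h1 : HasFDerivAt (localRep f Q) (simplexDeriv f Q) (Δ - Δ) := by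
    rw [sub_self]; exact DifferentiableAt.hasFDerivAt hf
  have h2 := HasFDerivAt.comp (f := fun Δ' : tangent S => Δ' - Δ) Δ h1
    ((hasFDerivAt_id Δ).sub_const Δ)
  rw [ContinuousLinearMap.comp_id] at h2
  refine h2.congr_of_eventuallyEq (Eventually.of_forall fun Δ' => ?_)
  simp only [Function.comp_apply]
  rw [← localRep_add f h, add_sub_cancel]

/-- First order expansion of a regular predictor, uniformly in the sample size. -/
lemma RegularPredictor.taylor {c : Predictor X S} (hc : RegularPredictor c) (x : X)
    {P : Simplex S} (hP : P ∈ simplexInterior S) {ε : ℝ} (hε : 0 < ε) :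
    ∃ δ > 0, ∀ (T : ℕ+) (Q : Simplex S) (Δ : tangent S), P.1 + Δ.1 = Q.1 → ‖Δ‖ < δ →
      |c T x Q - c T x P - simplexDeriv (c T x) P Δ| ≤ ε * ‖Δ‖ := by
  have heq := EquicontinuousWithinAt.eventually_norm_sub_lt (E := tangent S →L[ℝ] ℝ)
    (hc.deriv_equicontinuous (x, P) ⟨Set.mem_univ _, hP⟩) hε
  have hmap : Tendsto (fun Q : Simplex S => (x, Q)) (𝓝[simplexInterior S] P)
      (𝓝[Set.univ ×ˢ simplexInterior S] (x, P)) := by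
    refine tendsto_nhdsWithin_iff.2 ⟨?_, ?_⟩
    · exact ((Continuous.prodMk_right x).tendsto P).mono_left nhdsWithin_le_nhds
    · filter_upwards [self_mem_nhdsWithin] with Q hQ using ⟨Set.mem_univ _, hQ⟩
  obtain ⟨r, hr, hr'⟩ := Metric.eventually_nhds_iff.1
    (eventually_nhdsWithin_iff.1 (hmap.eventually heq))
  obtain ⟨δ, hδ, hδ'⟩ := Metric.eventually_nhds_iff.1 (eventually_exists_interior hP)
  refine ⟨min r δ, lt_min hr hδ, fun T Q Δ hQ hΔ => ?_⟩
  have hball : ∀ Δ' ∈ Metric.ball (0 : tangent S) (min r δ), ∃ Q' ∈ simplexInterior S,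
      P.1 + Δ'.1 = Q'.1 ∧ ‖simplexDeriv (c T x) Q' - simplexDeriv (c T x) P‖ ≤ ε := by
    intro Δ' hΔ'
    rw [Metric.mem_ball, lt_min_iff] at hΔ'
    obtain ⟨Q', hQ', h⟩ := hδ' hΔ'.2
    refine ⟨Q', hQ', h, ?_⟩
    exact (hr' (by rw [dist_eq_norm_of_add_eq h]; simpa using hΔ'.1) hQ' T).le
  -- Mean value inequality on a ball where the derivative differs from that at `P` by at most `ε`,
  -- for all `T` at once.
  have key := Convex.norm_image_sub_le_of_norm_hasFDerivWithin_le'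
    (f := localRep (c T x) P) (f' := fderiv ℝ (localRep (c T x) P))
    (φ := simplexDeriv (c T x) P) (C := ε) (s := Metric.ball (0 : tangent S) (min r δ))
    (x := 0) (y := Δ) (fun Δ' hΔ' => ?_) (fun Δ' hΔ' => ?_) (convex_ball _ _)
    (Metric.mem_ball_self (lt_min hr hδ)) (by simpa using hΔ)
  · rw [localRep_eq _ hQ, localRep_eq _ (Q := P) (by simp), sub_zero, Real.norm_eq_abs] at key
    exact key
  · obtain ⟨Q', hQ', h, -⟩ := hball Δ' hΔ'
    exact (hasFDerivAt_localRep_of_add_eq h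
      (hc.differentiable T x Q' hQ')).differentiableAt.hasFDerivAt.hasFDerivWithinAt
  · obtain ⟨Q', hQ', h, hb⟩ := hball Δ' hΔ'
    rwa [(hasFDerivAt_localRep_of_add_eq h (hc.differentiable T x Q' hQ')).fderiv]

end Taylor

/-! ### Lower bounds at moderate deviations by tilting. -/

section ModerateDeviations

lemma Real.one_add_le_exp_sub_sq {u : ℝ} (hu : |u| ≤ 1 / 2) :
    1 + u ≤ Real.exp (u - u ^ 2 / 2 + 2 * |u| ^ 3) := by
  have h1 : |(-u)| < 1 := by rw [abs_neg]; linarith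
  have h := (abs_le.1 (Real.abs_log_sub_add_sum_range_le h1 2)).2
  simp only [Finset.sum_range_succ, Finset.sum_range_zero, abs_neg, sub_neg_eq_add] at h
  norm_num at h
  have h3 : |u| ^ 3 / (1 - |u|) ≤ 2 * |u| ^ 3 := by
    rw [div_le_iff₀ (by linarith)]
    nlinarith [pow_nonneg (abs_nonneg u) 3]
  have hpos : 0 < 1 + u := by linarith [(abs_le.1 hu).1]
  rw [← Real.log_le_iff_le_exp hpos]
  linarith

lemma PNat.tendsto_coe_real_atTop : Tendsto (fun T : ℕ+ => (T : ℝ)) atTop atTop :=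
  tendsto_natCast_atTop_atTop.comp tendsto_PNat_val_atTop_atTop

variable {S : Type*} [Fintype S]

lemma mul_sq_sqrt_div {a : ℕ+ → ℝ} (ha : ∀ T, 0 ≤ a T) (T : ℕ+) :
    (T : ℝ) * Real.sqrt (a T / (T : ℝ)) ^ 2 = a T := by
  have := ha T
  rw [Real.sq_sqrt (by positivity)]
  field_simp

variable [DecidableEq S]

/-- The likelihood ratio of a linear tilt on the event that the empirical distribution is close to
the tilted one. -/
lemma prod_tilt_le {P Q : Simplex S} {g : S → ℝ} {θ r M v : ℝ} (hθ : 0 ≤ θ)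
    (hM : ∑ i, |g i| ≤ M) (hθM : θ * M ≤ 1 / 2) (hg : ∑ i, P.1 i * g i = 0)
    (hv : ∑ i, P.1 i * g i ^ 2 = v) (hQ : ∀ i, Q.1 i = P.1 i * (1 + θ * g i)) (T : ℕ+) (hr : 0 ≤ r)
    {ξ : ℕ → S} (hξ : ∀ i, |(empirical T ξ).1 i - Q.1 i| ≤ r) :
    ∏ t ∈ Finset.range T, Q.1 (ξ t) ≤
      Real.exp (T * (θ ^ 2 * v / 2 + 2 * θ * M * r + 4 * (θ * M) ^ 3)) *
        ∏ t ∈ Finset.range T, P.1 (ξ t) := by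
  have hgM : ∀ i, |g i| ≤ M := fun i =>
    (Finset.single_le_sum (f := fun i => |g i|) (fun j _ => abs_nonneg _)
      (Finset.mem_univ i)).trans hM
  set u : S → ℝ := fun i => θ * g i with hu
  have huM : ∀ i, |u i| ≤ θ * M := fun i => by
    rw [hu, abs_mul, abs_of_nonneg hθ]; exact mul_le_mul_of_nonneg_left (hgM i) hθ
  have hu2 : ∀ i, |u i| ≤ 1 / 2 := fun i => (huM i).trans hθM
  -- An upper bound for `log (1 + u)`, the log-likelihood ratio of one sample. Its mean under `Q` is
  -- the relative entropy `θ² * v / 2` up to cubic terms: weighting by `1 + u` turns `-u²/2` into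
  -- `+u²/2`.
  set ψ : S → ℝ := fun i => u i - u i ^ 2 / 2 + 2 * |u i| ^ 3 with hψ
  have hψabs : ∀ i, |ψ i| ≤ 2 * θ * |g i| := fun i => by
    have h1 : |u i| = θ * |g i| := by rw [hu, abs_mul, abs_of_nonneg hθ]
    have h2 : |ψ i| ≤ |u i| + |u i| ^ 2 / 2 + 2 * |u i| ^ 3 := by
      refine (abs_add_le _ _).trans (add_le_add ((abs_sub _ _).trans (add_le_add le_rfl ?_)) ?_)
      · rw [abs_of_nonneg (by positivity), sq_abs]
      · rw [abs_of_nonneg (by positivity)]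
    have h3 := hu2 i
    have h4 := abs_nonneg (u i)
    have h5 : |u i| ^ 2 ≤ |u i| / 2 := by nlinarith
    have h6 : |u i| ^ 3 ≤ |u i| / 4 := by nlinarith
    linarith
  have hbound : ∑ i, (empirical T ξ).1 i * ψ i ≤
      θ ^ 2 * v / 2 + 2 * θ * M * r + 4 * (θ * M) ^ 3 := by
    have hsplit : ∑ i, (empirical T ξ).1 i * ψ i =
        ∑ i, Q.1 i * ψ i + ∑ i, ((empirical T ξ).1 i - Q.1 i) * ψ i := by
      rw [← Finset.sum_add_distrib]
      exact Finset.sum_congr rfl fun i _ => by ring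
    have h1 : ∑ i, ((empirical T ξ).1 i - Q.1 i) * ψ i ≤ 2 * θ * M * r := by
      calc ∑ i, ((empirical T ξ).1 i - Q.1 i) * ψ i ≤ ∑ i, r * (2 * θ * |g i|) := by
            refine Finset.sum_le_sum fun i _ => (le_abs_self _).trans ?_
            rw [abs_mul]
            exact mul_le_mul (hξ i) (hψabs i) (abs_nonneg _) hr
        _ = r * (2 * θ) * ∑ i, |g i| := by
            rw [Finset.mul_sum]; exact Finset.sum_congr rfl fun i _ => by ring
        _ ≤ r * (2 * θ) * M := mul_le_mul_of_nonneg_left hM (by positivity)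
        _ = _ := by ring
    have h2 : ∑ i, Q.1 i * ψ i ≤ θ ^ 2 * v / 2 + 4 * (θ * M) ^ 3 := by
      have h3 : ∀ i ∈ Finset.univ, Q.1 i * ψ i ≤ θ * (P.1 i * g i) + θ ^ 2 / 2 * (P.1 i * g i ^ 2) +
          P.1 i * (4 * (θ * M) ^ 3) := by
        intro i _
        have hcube := pow_le_pow_left₀ (abs_nonneg (u i)) (huM i) 3
        have h4 : (1 + u i) * ψ i ≤ u i + u i ^ 2 / 2 + 4 * |u i| ^ 3 := by
          have h5 := abs_nonneg (u i)
          have h6 : u i * |u i| ^ 3 ≤ 1 / 2 * |u i| ^ 3 :=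
            mul_le_mul_of_nonneg_right ((le_abs_self _).trans (hu2 i)) (by positivity)
          have h7 : -(u i ^ 3) ≤ |u i| ^ 3 := by
            rw [← abs_pow]; exact neg_le_abs _
          simp only [hψ]
          have h8 : 0 ≤ |u i| ^ 3 := by positivity
          nlinarith
        rw [hQ i, mul_assoc]
        refine (mul_le_mul_of_nonneg_left (h4.trans (add_le_add_right
          (mul_le_mul_of_nonneg_left hcube (by norm_num)) _)) (P.2.1 i)).trans_eq ?_
        simp only [hu]
        ring
      refine (Finset.sum_le_sum h3).trans_eq ?_
      rw [Finset.sum_add_distrib, Finset.sum_add_distrib, ← Finset.mul_sum, ← Finset.mul_sum,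
        ← Finset.sum_mul, P.2.2, hg, hv]
      ring
    linarith
  calc ∏ t ∈ Finset.range T, Q.1 (ξ t)
      ≤ ∏ t ∈ Finset.range T, (Real.exp (ψ (ξ t)) * P.1 (ξ t)) := by
        refine Finset.prod_le_prod (fun t _ => Q.2.1 _) fun t _ => ?_
        rw [hQ, mul_comm]
        exact mul_le_mul_of_nonneg_right (Real.one_add_le_exp_sub_sq (hu2 _)) (P.2.1 _)
    _ = Real.exp (T * ∑ i, (empirical T ξ).1 i * ψ i) * ∏ t ∈ Finset.range T, P.1 (ξ t) := by
        rw [Finset.prod_mul_distrib, ← Real.exp_sum, sum_empirical_mul]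
    _ ≤ _ := by
        refine mul_le_mul_of_nonneg_right (Real.exp_le_exp.2 ?_)
          (Finset.prod_nonneg fun t _ => P.2.1 _)
        exact mul_le_mul_of_nonneg_left hbound (by positivity)

variable [MeasurableSpace S] [MeasurableSingletonClass S]

/-- The lower bound at moderate deviations: the empirical distribution follows a tilt of size
`s * √(a / T)` at the cost `s² v / 2` per unit of speed. -/
lemma eventually_le_sampleLaw_tilt (P : Simplex S) {a : ℕ+ → ℝ} (ha : ∀ T, 0 ≤ a T)
    (ha_top : Tendsto a atTop atTop)
    (ha_sub : Tendsto (fun T : ℕ+ => a T / (T : ℝ)) atTop (𝓝 0)) {g : S → ℝ} {v s q η : ℝ}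
    (hs : 0 ≤ s) (hg : ∑ i, P.1 i * g i = 0) (hv : ∑ i, P.1 i * g i ^ 2 = v)
    (hq : s ^ 2 * v / 2 < q) (hη : 0 < η) :
    ∀ᶠ T : ℕ+ in atTop, 1 / 2 * Real.exp (-(q * a T)) ≤ (sampleLaw P).real {ξ | empirical T ξ ∈
      {Q : Simplex S | ∀ i, |Q.1 i - P.1 i * (1 + s * Real.sqrt (a T / (T : ℝ)) * g i)| ≤
        η * Real.sqrt (a T / (T : ℝ))}} := by
  set M := ∑ i, |g i|
  have hM0 : 0 ≤ M := Finset.sum_nonneg fun i _ => abs_nonneg _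
  let τ : ℕ+ → ℝ := fun T => Real.sqrt (a T / (T : ℝ))
  have hτ : Tendsto τ atTop (𝓝 0) := by
    have := ha_sub.sqrt
    rwa [Real.sqrt_zero] at this
  -- The radius `ρ * τ` must be small enough for the likelihood error to fit below `q`. A fixed `ρ`
  -- still suffices for concentration under the tilt, since the exponent `T * (ρ * τ)² / 8 = a T *
  -- ρ² / 8` diverges.
  obtain ⟨ρ, hρ0, hρη, hρ⟩ : ∃ ρ > 0, ρ ≤ η ∧ s ^ 2 * v / 2 + 2 * s * M * ρ < q := by
    have hlim : Tendsto (fun ρ : ℝ => s ^ 2 * v / 2 + 2 * s * M * ρ) (𝓝[>] 0)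
        (𝓝 (s ^ 2 * v / 2 + 2 * s * M * 0)) :=
      ((continuous_const.add (continuous_const.mul continuous_id)).tendsto 0).mono_left
        nhdsWithin_le_nhds
    rw [mul_zero, add_zero] at hlim
    obtain ⟨ρ, h1, h2, h3⟩ := ((hlim.eventually (gt_mem_nhds hq)).and
      (eventually_mem_nhdsWithin.and (nhdsWithin_le_nhds (gt_mem_nhds hη)))).exists
    exact ⟨ρ, h2, le_of_lt h3, h1⟩
  have hsmall : Tendsto (fun T => s * τ T * M) atTop (𝓝 0) := by
    simpa using (hτ.const_mul s).mul_const M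
  have hr : Tendsto (fun T => ρ * τ T) atTop (𝓝 0) := by simpa using hτ.const_mul ρ
  have hrate : Tendsto (fun T => s ^ 2 * v / 2 + 2 * s * M * ρ + 4 * (s * M) ^ 3 * τ T) atTop
      (𝓝 (s ^ 2 * v / 2 + 2 * s * M * ρ)) := by
    simpa using (hτ.const_mul (4 * (s * M) ^ 3)).const_add (s ^ 2 * v / 2 + 2 * s * M * ρ)
  have hfar : Tendsto (fun T => (Fintype.card S : ℝ) * (2 * Real.exp (-(a T * (ρ ^ 2 / 8))))) atTop
      (𝓝 0) := by
    have := (Real.tendsto_exp_neg_atTop_nhds_zero.comp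
      (ha_top.atTop_mul_const (show 0 < ρ ^ 2 / 8 by positivity))).const_mul 2
    simpa using this.const_mul (Fintype.card S : ℝ)
  filter_upwards [hsmall.eventually (gt_mem_nhds (show (0 : ℝ) < 1 / 2 by norm_num)),
    hr.eventually (gt_mem_nhds one_pos), hrate.eventually (gt_mem_nhds hρ),
    hfar.eventually (gt_mem_nhds (show (0 : ℝ) < 1 / 2 by norm_num))] with T hT1 hT2 hT3 hT4
  have hτ0 : 0 ≤ τ T := Real.sqrt_nonneg _
  have hT := mul_sq_sqrt_div ha T
  change (T : ℝ) * τ T ^ 2 = a T at hT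
  have hnonneg : ∀ i, 0 ≤ 1 + s * τ T * g i := fun i => by
    have h1 : |s * τ T * g i| ≤ s * τ T * M := by
      rw [abs_mul, abs_of_nonneg (mul_nonneg hs hτ0)]
      exact mul_le_mul_of_nonneg_left (Finset.single_le_sum (f := fun i => |g i|)
        (fun j _ => abs_nonneg _) (Finset.mem_univ i)) (mul_nonneg hs hτ0)
    linarith [(abs_le.1 h1).1]
  let Q : Simplex S := ⟨fun i => P.1 i * (1 + s * τ T * g i), fun i =>
    mul_nonneg (P.2.1 i) (hnonneg i), by
      have : ∀ i, P.1 i * (1 + s * τ T * g i) = P.1 i + s * τ T * (P.1 i * g i) := fun i => by ring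
      simp only [this, Finset.sum_add_distrib, ← Finset.mul_sum, P.2.2, hg]
      ring⟩
  set A : Set (Simplex S) := {R | ∀ i, |R.1 i - Q.1 i| ≤ ρ * τ T}
  have hAsub : {ξ : ℕ → S | empirical T ξ ∈ A} ⊆ {ξ | empirical T ξ ∈
      {R : Simplex S | ∀ i, |R.1 i - P.1 i * (1 + s * τ T * g i)| ≤ η * τ T}} :=
    fun ξ hξ i => (hξ i).trans (mul_le_mul_of_nonneg_right hρη hτ0)
  refine le_trans ?_ (measureReal_mono hAsub (measure_ne_top _ _))
  have hQA : 1 / 2 ≤ (sampleLaw Q).real {ξ | empirical T ξ ∈ A} := by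
    have hcover : (Set.univ : Set (ℕ → S)) ⊆ {ξ | empirical T ξ ∈ A} ∪
        {ξ | ∃ i, ρ * τ T ≤ |(empirical T ξ).1 i - Q.1 i|} := by
      intro ξ _
      by_cases h : ∃ i, ρ * τ T ≤ |(empirical T ξ).1 i - Q.1 i|
      · exact Or.inr h
      · push Not at h
        exact Or.inl fun i => (h i).le
    have h1 := (measureReal_mono hcover (measure_ne_top (sampleLaw Q) _)).trans
      (measureReal_union_le _ _)
    rw [probReal_univ] at h1
    have h2 := sampleLaw_real_empirical_far_le Q T (mul_nonneg hρ0.le hτ0) hT2.le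
    rw [show (T : ℝ) * ((ρ * τ T) ^ 2 / 8) = a T * (ρ ^ 2 / 8) by rw [← hT]; ring] at h2
    linarith
  have hlik := sampleLaw_real_le_of_likelihood P Q T A (Real.exp (q * a T)) fun ξ hξ => by
    refine (prod_tilt_le (P := P) (Q := Q) (g := g) (θ := s * τ T) (M := M) (mul_nonneg hs hτ0)
      le_rfl hT1.le hg hv (fun i => rfl) T (mul_nonneg hρ0.le hτ0) hξ).trans ?_
    refine mul_le_mul_of_nonneg_right (Real.exp_le_exp.2 ?_)
      (Finset.prod_nonneg fun t _ => P.2.1 _)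
    calc (T : ℝ) * ((s * τ T) ^ 2 * v / 2 + 2 * (s * τ T) * M * (ρ * τ T) + 4 * (s * τ T * M) ^ 3)
        = (s ^ 2 * v / 2 + 2 * s * M * ρ + 4 * (s * M) ^ 3 * τ T) * (T * τ T ^ 2) := by ring
      _ ≤ q * a T := by rw [hT]; exact mul_le_mul_of_nonneg_right hT3.le (ha T)
  rw [Real.exp_neg, ← div_eq_mul_inv, div_le_iff₀ (Real.exp_pos _), mul_comm]
  exact hQA.trans hlik

end ModerateDeviations

/-! ### Necessity of the variance penalty. -/

section LowerBound

variable {X S : Type*} [TopologicalSpace X] [Fintype S] [DecidableEq S] [MeasurableSpace S]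
  [MeasurableSingletonClass S]

/-- A predictor with the guarantee is asymptotically no smaller than the cost. -/
lemma eventually_cost_sub_le {l : X → S → ℝ} {a : ℕ+ → ℝ} (ha_top : Tendsto a atTop atTop)
    {c : Predictor X S} (hc : RegularPredictor c)
    (hg : OutOfSampleGuarantee l a c (simplexInterior S)) (x : X) {P : Simplex S}
    (hP : P ∈ simplexInterior S) {ε : ℝ} (hε : 0 < ε) :
    ∀ᶠ T : ℕ+ in atTop, cost l x P - ε ≤ c T x P := by
  have heq := Metric.equicontinuousAt_iff_right.1 (hc.equicontinuous (x, P)) ε hε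
  obtain ⟨r, hr0, hr⟩ := Metric.eventually_nhds_iff.1
    (((Continuous.prodMk_right x).tendsto P).eventually heq)
  obtain ⟨ρ, hρ0, hρ⟩ := exists_between (lt_min hr0 one_pos)
  have hfar : Tendsto (fun T : ℕ+ => (Fintype.card S : ℝ) *
      (2 * Real.exp (-((T : ℝ) * (ρ ^ 2 / 8))))) atTop (𝓝 0) := by
    have := (Real.tendsto_exp_neg_atTop_nhds_zero.comp
      (PNat.tendsto_coe_real_atTop.atTop_mul_const
        (show 0 < ρ ^ 2 / 8 by positivity))).const_mul 2
    simpa using this.const_mul (Fintype.card S : ℝ)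
  have hexp : Tendsto (fun T => Real.exp (-(1 / 2 * a T))) atTop (𝓝 0) :=
    Real.tendsto_exp_neg_atTop_nhds_zero.comp (ha_top.const_mul_atTop (by norm_num))
  filter_upwards [hfar.eventually (gt_mem_nhds (show (0 : ℝ) < 1 / 2 by norm_num)),
    hexp.eventually (gt_mem_nhds (show (0 : ℝ) < 1 / 2 by norm_num)),
    eventually_le_exp_of_limsup_log_rate_le ha_top (hg x P hP) (q := 1 / 2) (by norm_num)]
    with T hT1 hT2 hT3
  by_contra hlt
  rw [not_le] at hlt
  rw [disappointment_eq_ofReal, ENNReal.ofReal_le_ofReal_iff (Real.exp_nonneg _)] at hT3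
  -- If the predictor were too small at `P`, equicontinuity would make every nearby empirical
  -- distribution disappointing: two events of probability below `1 / 2` would cover the space.
  have hcover : (Set.univ : Set (ℕ → S)) ⊆
      {ξ | empirical T ξ ∈ {Q | cost l x P > c T x Q}} ∪
        {ξ | ∃ i, ρ ≤ |(empirical T ξ).1 i - P.1 i|} := by
    intro ξ _
    by_cases h : ∃ i, ρ ≤ |(empirical T ξ).1 i - P.1 i|
    · exact Or.inr h
    · left
      push Not at h
      have := hr (((simplex_dist_lt_iff hρ0).2 h).trans (hρ.trans_le (min_le_left _ _))) T
      rw [Real.dist_eq] at this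
      change cost l x P > c T x (empirical T ξ)
      linarith [(abs_lt.1 this).1]
  have h1 := (measureReal_mono hcover (measure_ne_top (sampleLaw P) _)).trans
    (measureReal_union_le _ _)
  rw [probReal_univ] at h1
  have h2 := sampleLaw_real_empirical_far_le P T hρ0.le (hρ.le.trans (min_le_right _ _))
  linarith

/-- At sample sizes where a predictor with the guarantee nearly touches the cost, its derivative is
nearly that of the cost. -/
lemma eventually_simplexDeriv_le {l : X → S → ℝ} {a : ℕ+ → ℝ} (ha_top : Tendsto a atTop atTop)
    {c : Predictor X S} (hc : RegularPredictor c)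
    (hg : OutOfSampleGuarantee l a c (simplexInterior S)) (x : X) {P : Simplex S}
    (hP : P ∈ simplexInterior S) {ρ : ℕ+ → ℝ} (hρ : Tendsto ρ atTop (𝓝 0)) (w : tangent S)
    {ε : ℝ} (hε : 0 < ε) :
    ∀ᶠ T : ℕ+ in atTop, c T x P ≤ cost l x P + ρ T →
      simplexDeriv (c T x) P w ≤ tangentPairing (l x) w + ε := by
  obtain ⟨δ, hδ, htaylor⟩ := hc.taylor x hP (ε := ε / (3 * (‖w‖ + 1))) (by positivity)
  -- A derivative too large along `w` would push the predictor below the cost at `P - h • w`. The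
  -- step `h` is fixed before `T` grows; the Taylor error, the asymptotic bound at `Q` and `ρ T`
  -- each cost at most `h * ε / 3`.
  have hlim : Tendsto (fun h : ℝ => -(h • w)) (𝓝[>] 0) (𝓝 0) := by
    have : Tendsto (fun h : ℝ => -(h • w)) (𝓝 0) (𝓝 (-((0 : ℝ) • w))) :=
      (Continuous.neg (continuous_id.smul continuous_const)).tendsto 0
    rw [zero_smul, neg_zero] at this
    exact this.mono_left nhdsWithin_le_nhds
  obtain ⟨h, ⟨Q, hQ, hPQ⟩, hh0, hhδ⟩ := ((hlim.eventually (eventually_exists_interior hP)).and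
    (eventually_mem_nhdsWithin.and (hlim.eventually (Metric.ball_mem_nhds 0 hδ)))).exists
  have hh : 0 < h := hh0
  replace hhδ : ‖-(h • w)‖ < δ := by simpa using hhδ
  filter_upwards [eventually_cost_sub_le ha_top hc hg x hQ (ε := h * ε / 3) (by positivity),
    hρ.eventually (gt_mem_nhds (show 0 < h * ε / 3 by positivity))] with T hT1 hT2 hT3
  have h1 := (abs_le.1 (htaylor T Q _ hPQ hhδ)).2
  rw [cost_eq_add_tangentPairing l x hPQ] at hT1
  rw [map_neg, map_smul, smul_eq_mul] at h1 hT1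
  rw [norm_neg, norm_smul, Real.norm_of_nonneg hh.le] at h1
  have h2 : ε / (3 * (‖w‖ + 1)) * (h * ‖w‖) ≤ h * ε / 3 := by
    rw [div_mul_eq_mul_div, div_le_div_iff₀ (by positivity) (by norm_num)]
    nlinarith [mul_pos hε hh]
  refine le_of_mul_le_mul_left ?_ hh
  linarith

/-- A smaller excess would make every empirical distribution near a suitable tilt of `P`
disappointing, and such distributions are too likely for the guarantee. -/
lemma eventually_lt_scaled_excess {l : X → S → ℝ} {a : ℕ+ → ℝ} (ha : ∀ T, 0 ≤ a T)
    (ha_top : Tendsto a atTop atTop)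
    (ha_sub : Tendsto (fun T : ℕ+ => a T / (T : ℝ)) atTop (𝓝 0))
    {c : Predictor X S} (hc : RegularPredictor c)
    (hg : OutOfSampleGuarantee l a c (simplexInterior S)) (x : X) {P : Simplex S}
    (hP : P ∈ simplexInterior S) {b : ℝ} (hb : b < Real.sqrt (2 * lossVar l x P)) :
    ∀ᶠ T : ℕ+ in atTop, cost l x P + b * Real.sqrt (a T / (T : ℝ)) < c T x P := by
  set v := lossVar l x P with hv
  have hv0 : 0 ≤ v := lossVar_nonneg l x P
  -- For `v > 0`, `s` lies just below `√(2 * v) / v`, the tilt whose rate is exactly `1`.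
  obtain ⟨s, hs0, hbs, hs1⟩ : ∃ s, 0 ≤ s ∧ b < s * v ∧ s ^ 2 * v / 2 < 1 := by
    rcases hv0.eq_or_lt with h0 | hpos
    · refine ⟨0, le_rfl, ?_, by norm_num⟩
      rw [← h0, mul_zero, Real.sqrt_zero] at hb
      simpa using hb
    · have hlt : max 0 (b / v) < Real.sqrt (2 * v) / v := by
        refine max_lt (div_pos (Real.sqrt_pos.2 (by positivity)) hpos) ?_
        exact div_lt_div_of_pos_right hb hpos
      obtain ⟨s, h1, h2⟩ := exists_between hlt
      have hs0 : 0 ≤ s := (le_max_left _ _).trans h1.le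
      refine ⟨s, hs0, (div_lt_iff₀ hpos).1 ((le_max_right _ _).trans_lt h1), ?_⟩
      have h3 : s * v < Real.sqrt (2 * v) := (lt_div_iff₀ hpos).1 h2
      have h4 : (s * v) ^ 2 < 2 * v := by
        rw [← Real.sq_sqrt (show 0 ≤ 2 * v by positivity)]
        exact pow_lt_pow_left₀ h3 (by positivity) two_ne_zero
      have h5 : s ^ 2 * v < 2 := by
        by_contra h
        nlinarith [mul_le_mul_of_nonneg_right (not_lt.1 h) hpos.le]
      linarith
  obtain ⟨q, hsq, hq1⟩ := exists_between hs1
  obtain ⟨q', hqq', hq'1⟩ := exists_between hq1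
  set κ := s * v - b with hκ
  have hκ0 : 0 < κ := by linarith
  let g : S → ℝ := fun i => cost l x P - l x i
  have hPg : ∑ i, P.1 i * g i = 0 := by
    have := sum_mul_sub_cost l x P
    rw [← neg_eq_zero, ← Finset.sum_neg_distrib, ← this]
    exact Finset.sum_congr rfl fun i _ => by simp only [g]; ring
  have hPg2 : ∑ i, P.1 i * g i ^ 2 = v :=
    Finset.sum_congr rfl fun i _ => by simp only [g]; ring
  let w : tangent S := ⟨fun i => P.1 i * g i, hPg⟩
  have hlw : tangentPairing (l x) w = -v := by
    have : ∀ i, l x i * (P.1 i * g i) = cost l x P * (P.1 i * g i) - P.1 i * g i ^ 2 := fun i => by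
      simp only [g]; ring
    rw [tangentPairing_apply]
    simp only [w, this, Finset.sum_sub_distrib, ← Finset.mul_sum, hPg, hPg2]
    ring
  obtain ⟨K, hK⟩ := hc.deriv_bounded {P} isCompact_singleton (Set.singleton_subset_iff.2 hP)
  replace hK : ∀ T : ℕ+, ‖simplexDeriv (c T x) P‖ ≤ K := fun T => hK T x P rfl
  have hK0 : 0 ≤ K := (ContinuousLinearMap.opNorm_nonneg _).trans (hK 1)
  -- The gap `κ` pays for three errors of at most `κ / 4` each: the slope along `w`, the distance to
  -- the exact tilt, and the Taylor remainder. A margin of `κ / 4` remains.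
  set ε := κ / (4 * (s + 1)) with hε
  set η := min 1 (κ / (4 * (K + 1))) with hη
  set ε' := κ / (4 * (s * ‖w‖ + 1)) with hε'
  have hε0 : 0 < ε := by positivity
  have hη0 : 0 < η := by positivity
  have hε'0 : 0 < ε' := by positivity
  have hsε : s * ε ≤ κ / 4 := by
    rw [hε, mul_div_assoc', div_le_div_iff₀ (by positivity) (by norm_num)]
    nlinarith
  have hKη : K * η ≤ κ / 4 := by
    refine (mul_le_mul_of_nonneg_left (min_le_right _ _) hK0).trans ?_
    rw [mul_div_assoc', div_le_div_iff₀ (by positivity) (by norm_num)]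
    nlinarith
  have hε'w : ε' * (s * ‖w‖ + η) ≤ κ / 4 := by
    have h1 : ε' * (s * ‖w‖ + η) ≤ ε' * (s * ‖w‖ + 1) :=
      mul_le_mul_of_nonneg_left (by linarith [min_le_left 1 (κ / (4 * (K + 1)))]) hε'0.le
    refine h1.trans_eq ?_
    have : s * ‖w‖ + 1 ≠ 0 := by positivity
    rw [hε']
    field_simp
  obtain ⟨δ, hδ, htaylor⟩ := hc.taylor x hP hε'0
  let τ : ℕ+ → ℝ := fun T => Real.sqrt (a T / (T : ℝ))
  have hτ : Tendsto τ atTop (𝓝 0) := by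
    have := ha_sub.sqrt
    rwa [Real.sqrt_zero] at this
  have hbτ : Tendsto (fun T => b * τ T) atTop (𝓝 0) := by simpa using hτ.const_mul b
  have hδτ : Tendsto (fun T => τ T * (s * ‖w‖ + η)) atTop (𝓝 0) := by
    simpa using hτ.mul_const (s * ‖w‖ + η)
  have hexp : Tendsto (fun T => Real.exp (-((q' - q) * a T))) atTop (𝓝 0) :=
    Real.tendsto_exp_neg_atTop_nhds_zero.comp (ha_top.const_mul_atTop (by linarith))
  filter_upwards [eventually_simplexDeriv_le ha_top hc hg x hP hbτ w hε0,
    eventually_le_sampleLaw_tilt P ha ha_top ha_sub hs0 hPg hPg2 hsq hη0,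
    eventually_le_exp_of_limsup_log_rate_le ha_top (hg x P hP) hq'1,
    hδτ.eventually (gt_mem_nhds hδ), ha_top.eventually_gt_atTop 0,
    hexp.eventually (gt_mem_nhds (show (0 : ℝ) < 1 / 2 by norm_num))] with T hT1 hT2 hT3 hT4 hT5 hT6
  by_contra hle
  rw [not_lt] at hle
  have hD := hT1 hle
  rw [hlw] at hD
  have hτ0 : 0 < τ T := Real.sqrt_pos.2 (by positivity)
  have hsub : ∀ Q : Simplex S,
      (∀ i, |Q.1 i - P.1 i * (1 + s * τ T * g i)| ≤ η * τ T) → cost l x P > c T x Q := by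
    intro Q hQ
    let Δ : tangent S := ⟨Q.1 - P.1, mem_tangent_iff.2 (by
      simp [Finset.sum_sub_distrib, P.2.2, Q.2.2])⟩
    let R : tangent S := Δ - (s * τ T) • w
    have hΔR : Δ = (s * τ T) • w + R := by simp only [R]; abel
    have hR : ‖R‖ ≤ η * τ T := by
      rw [Submodule.coe_norm, pi_norm_le_iff_of_nonneg (by positivity)]
      intro i
      refine le_of_eq_of_le ?_ (hQ i)
      simp only [R, Δ, w, Submodule.coe_sub, Submodule.coe_smul, Pi.sub_apply, Pi.smul_apply,
        smul_eq_mul, Real.norm_eq_abs]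
      congr 1
      ring
    have hΔ : ‖Δ‖ ≤ τ T * (s * ‖w‖ + η) := by
      rw [hΔR]
      refine (norm_add_le _ _).trans ?_
      rw [norm_smul, Real.norm_of_nonneg (by positivity)]
      linarith
    have h1 := (abs_le.1 (htaylor T Q Δ (by simp [Δ]) (hΔ.trans_lt hT4))).2
    have h2 : simplexDeriv (c T x) P Δ ≤ s * τ T * (-v + ε) + K * (η * τ T) := by
      rw [hΔR, map_add, map_smul, smul_eq_mul]
      refine add_le_add (mul_le_mul_of_nonneg_left hD (by positivity)) ?_
      refine (le_abs_self _).trans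
        (((simplexDeriv (c T x) P).le_opNorm R).trans ?_)
      exact mul_le_mul (hK T) hR (norm_nonneg _) hK0
    have h3 := mul_le_mul_of_nonneg_left hΔ hε'0.le
    have h4 : b + s * (-v + ε) + K * η + ε' * (s * ‖w‖ + η) < 0 := by linarith
    have h5 := mul_neg_of_pos_of_neg hτ0 h4
    change c T x P ≤ cost l x P + b * τ T at hle
    nlinarith
  rw [disappointment_eq_ofReal, ENNReal.ofReal_le_ofReal_iff (Real.exp_nonneg _)] at hT3
  have h1 := hT2.trans ((measureReal_mono (fun ξ hξ => hsub _ hξ)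
    (measure_ne_top (sampleLaw P) _)).trans hT3)
  -- As `q < q'`, the upper bound from the guarantee is eventually less than half of `exp (-(q * a
  -- T))`, against the tilt's lower bound.
  have h2 : Real.exp (-(q' * a T)) = Real.exp (-((q' - q) * a T)) * Real.exp (-(q * a T)) := by
    rw [← Real.exp_add]; congr 1; ring
  rw [h2] at h1
  exact absurd (le_of_mul_le_mul_right h1 (Real.exp_pos _)) (not_le.2 hT6)

end LowerBound

/-! ### From the scaled excess to the order and the lower limit. -/

section Preference

variable {X S : Type*} [Fintype S]

/-- The factor `√(a T / T)` cancels, so each positive `b < σ = √(2 * v)` bounds the ratio eventually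
by `σ / b`, and `b` tends to `σ`. At zero variance the numerator is `0` and the ratio is `0` or, by
convention, `1`. -/
lemma svp_preferred {l : X → S → ℝ} {a : ℕ+ → ℝ} (ha : ∀ T, 0 ≤ a T)
    (ha_top : Tendsto a atTop atTop) {c : Predictor X S}
    (h : ∀ x, ∀ P ∈ simplexInterior S, ∀ b < Real.sqrt (2 * lossVar l x P),
      ∀ᶠ T : ℕ+ in atTop, cost l x P + b * Real.sqrt (a T / (T : ℝ)) < c T x P) :
    Preferred l (svp l a) c := by
  intro x P hP
  have hsvp : ∀ T : ℕ+, |svp l a T x P - cost l x P| =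
      Real.sqrt (a T / (T : ℝ)) * Real.sqrt (2 * lossVar l x P) := fun T => by
    have := ha T
    rw [svp, add_sub_cancel_left, abs_of_nonneg (Real.sqrt_nonneg _), ← Real.sqrt_mul (by positivity)]
    congr 1
    ring
  rcases (lossVar_nonneg l x P).eq_or_lt with h0 | hpos
  · refine limsup_le_of_le (h := Eventually.of_forall fun T => ?_)
    rw [hsvp, ← h0, mul_zero, Real.sqrt_zero, mul_zero, ratio]
    split_ifs <;> simp
  · set σ := Real.sqrt (2 * lossVar l x P)
    have hσ : 0 < σ := Real.sqrt_pos.2 (by positivity)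
    have hlim : Tendsto (fun b : ℝ => ENNReal.ofReal (σ / b)) (𝓝[<] σ) (𝓝 1) := by
      have h1 : Tendsto (fun b : ℝ => σ / b) (𝓝[<] σ) (𝓝 (σ / σ)) :=
        (tendsto_const_nhds.div tendsto_id hσ.ne').mono_left nhdsWithin_le_nhds
      rw [div_self hσ.ne'] at h1
      simpa using ENNReal.tendsto_ofReal h1
    refine ge_of_tendsto hlim ?_
    filter_upwards [eventually_mem_nhdsWithin, nhdsWithin_le_nhds (lt_mem_nhds hσ)] with b hb hb0
    replace hb0 : 0 < b := hb0
    refine limsup_le_of_le (h := ?_)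
    filter_upwards [h x P hP b hb, ha_top.eventually_gt_atTop 0] with T hT haT
    have hτ0 : 0 < Real.sqrt (a T / (T : ℝ)) := Real.sqrt_pos.2 (by positivity)
    have hbτ := mul_pos hb0 hτ0
    have hpos' : 0 < |c T x P - cost l x P| := abs_pos.2 (by linarith)
    rw [hsvp, ratio, if_neg (fun hc => hpos'.ne' hc.2), ← ENNReal.ofReal_div_of_pos hpos']
    refine ENNReal.ofReal_le_ofReal ?_
    rw [div_le_div_iff₀ hpos' hb0]
    have h1 : b * Real.sqrt (a T / (T : ℝ)) ≤ |c T x P - cost l x P| :=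
      le_trans (by linarith) (le_abs_self _)
    nlinarith [mul_le_mul_of_nonneg_left h1 hσ.le]

lemma le_liminf_scaled_excess {l : X → S → ℝ} {a : ℕ+ → ℝ} (ha_top : Tendsto a atTop atTop)
    {c : Predictor X S} {x : X} {P : Simplex S} {σ : ℝ}
    (h : ∀ b < σ, ∀ᶠ T : ℕ+ in atTop,
      cost l x P + b * Real.sqrt (a T / (T : ℝ)) < c T x P) :
    (σ : EReal) ≤ liminf (fun T : ℕ+ =>
      ((Real.sqrt ((T : ℝ) / a T) * (c T x P - cost l x P) : ℝ) : EReal)) atTop := by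
  refine EReal.ge_of_forall_gt_iff_ge.1 fun b hb => ?_
  refine le_liminf_of_le (h := ?_)
  filter_upwards [h b (EReal.coe_lt_coe_iff.1 hb), ha_top.eventually_gt_atTop 0] with T hT haT
  have hτ0 : 0 < Real.sqrt (a T / (T : ℝ)) := Real.sqrt_pos.2 (by positivity)
  rw [EReal.coe_le_coe_iff, ← inv_div, Real.sqrt_inv, inv_mul_eq_div, le_div_iff₀ hτ0]
  linarith

end Preference

theorem mainTheorem1 {X S : Type*} [TopologicalSpace X] [CompactSpace X]
    [Fintype S] [DecidableEq S] [MeasurableSpace S] [MeasurableSingletonClass S]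
    (l : X → S → ℝ) (hl : ∀ i, Continuous fun x => l x i)
    (a : ℕ+ → ℝ) (ha_nonneg : ∀ T, 0 ≤ a T) (ha_top : Tendsto a atTop atTop)
    (ha_sub : Tendsto (fun T : ℕ+ => a T / (T : ℝ)) atTop (𝓝 0)) :
    RegularPredictor (svp l a) ∧
    OutOfSampleGuarantee l a (svp l a) Set.univ ∧
    ∀ c : Predictor X S, RegularPredictor c → OutOfSampleGuarantee l a c (simplexInterior S) →
      Preferred l (svp l a) c ∧
      ∀ x : X, ∀ P ∈ simplexInterior S,
        ((Real.sqrt (2 * lossVar l x P) : ℝ) : EReal) ≤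
          liminf (fun T : ℕ+ =>
            ((Real.sqrt ((T : ℝ) / a T) * (c T x P - cost l x P) : ℝ) : EReal)) atTop := by
  refine ⟨svp_regular hl ha_nonneg ha_sub, svp_guarantee l ha_nonneg ha_top ha_sub,
    fun c hc hg => ?_⟩
  have h := fun x P (hP : P ∈ simplexInterior S) b
    (hb : b < Real.sqrt (2 * lossVar l x P)) =>
      eventually_lt_scaled_excess ha_nonneg ha_top ha_sub hc hg x hP hb
  exact ⟨svp_preferred ha_nonneg ha_top h,
    fun x P hP => le_liminf_scaled_excess ha_top (h x P hP)⟩
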